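/- **Model data.** Let $d\in\{2,3\}$, let $\Omega\subset\mathbb R^d$ be a bounded polytopic domain (boundary regularity beyond the existence of the meshes below is not needed), $T>0$, and let $\kappa_p,\lambda_p,\lambda_q,\mu_{pq}>0$ with $\Upsilon_{pq}:=\kappa_p\mu_{pq}-\lambda_p\lambda_q>0$. Put $\mathcal E_p=\kappa_p/\lambda_p$, $\mathcal E_q=\Upsilon_{pq}/(\lambda_q\mu_{pq})$, $$u_p(w)=\mathcal E_p\frac{e^w}{1+e^w},\quad u_q(w)=\mathcal E_qe^w,\quad f_p(p,q)=-p(\lambda_p+\mu_{pq}q)+\kappa_p,\quad f_q(p,q)=-q(\lambda_q-\mu_{pq}p),$$ $$s_p(p)=p\log p+(\mathcal E_p-p)\log(\mathcal E_p-p)+\max\{\mathcal E_p\log(2\mathcal E_p^{-1}),0\},\quad s_q(q)=q(\log(\mathcal E_q^{-1}q)-1)+\mathcal E_q \qquad (0\log 0:=0),$$ so that $s_p''(p)=\frac1{p(1-\mathcal E_p^{-1}p)}$, $s_q''(q)=\frac1q$, and $C_f=\frac{1+\log2}{\log2}\,\mathcal E_p\big(\frac{\lambda_p}{\mathcal E_q}+2\mu_{pq}\big)$.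 Let $D\in L^\infty(\Omega)^{d\times d}$ be symmetric a.e. with $z^\top Dz\ge d_{\rm upd}|z|^2$ for all $z\in\mathbb R^d$, a.e. in $\Omega$, where $d_{\rm upd}>0$. Let $p_0$ be measurable with $0\le p_0\le\mathcal E_p$ a.e. in $\Omega$, and let $q_0\in L^\infty(\Omega)$ with $q_0\ge0$ a.e. in $\Omega$. **Discretization.** Let $\mathcal T_h$ be a conforming simplicial partition of $\Omega$ with set of internal facets $\mathcal F_h^{\mathcal I}$, and for a fixed degree $\ell\ge1$ let $\mathcal W=\prod_{K\in\mathcal T_h}\mathbb P_\ell(K)$, $\mathcal R=\prod_{K\in\mathcal T_h}\mathbb P_\ell(K)^d$, with $L^2$-orthogonal projections $\Pi_{\mathcal W},\Pi_{\mathcal R}$. On a facet $F\in\mathcal F_h^{\mathcal I}$ shared by $K_1,K_2$, with outward unit normals $n_{K_1},n_{K_2}$ and a weight $\gamma_F\in[0,1]$, put $[\![v]\!]_N=v|_{K_1}n_{K_1}+v|_{K_2}n_{K_2}$, $\{\!\{\phi\}\!\}_{1-\gamma_F}=\gamma_F\,\phi|_{K_1}+(1-\gamma_F)\,\phi|_{K_2}$,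 $\mathsf h=\min\{h_{K_1},h_{K_2}\}$ ($h_K$ the diameter of $K$), and, with fixed $\eta_0>0$, $$\eta_F=\eta_0\ell^2\frac{2\,\delta_1\delta_2}{\delta_1+\delta_2},\qquad \delta_i=n_{K_i}^\top D|_{K_i}n_{K_i},$$ where the trace on $F$ from $K_i$ is $\delta_i(x)=\limsup_{r\to0^+}$ of the mean of $n_{K_i}^\top Dn_{K_i}$ over $K_i\cap B(x,r)$ (the usual trace whenever that exists, e.g. for $D$ continuous up to the boundary on each element). The lifting $\mathcal L:\mathcal W\to\mathcal R$, the discrete gradient $\nabla_{\rm LDG}:\mathcal W\to\mathcal R$ and the discrete divergence ${\rm div}_{\rm LDG}:\mathcal R\to\mathcal W$ are defined by $$(\mathcal L(v),\phi)_\Omega=\sum_{F\in\mathcal F_h^{\mathcal I}}([\![v]\!]_N,\{\!\{\phi\}\!\}_{1-\gamma_F})_F,\quad (\nabla_{\rm LDG}v,\phi)_\Omega=(\nabla_hv-\mathcal L(v),\phi)_\Omega,\quad ({\rm div}_{\rm LDG}r,\psi)_\Omega=-(r,\nabla_{\rm LDG}\psi)_\Omega$$ for all $\phi\in\mathcal R$,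 $\psi\in\mathcal W$, where $\nabla_h$ is the elementwise gradient. Let $(\cdot,\cdot)_{\rm LDG}$ be an inner product and $\|\cdot\|_{\rm DG}$ a norm on $\mathcal W$ such that, for all $v\in\mathcal W$, $$(v,v)_{\rm LDG}\ge C_{\rm coer}\|v\|_{\rm DG}^2,\qquad \|v\|_{L^\infty(\Omega)}\le C_{\rm Sob}\|v\|_{\rm DG},$$ where the constants $C_{\rm coer},C_{\rm Sob}>0$ do not depend on the mesh. Let $\varepsilon>0$, and let $0=t_0<\dots<t_{N_t}=T$ be a time mesh with steps $\tau_n=t_n-t_{n-1}$ and $\tau=\max_n\tau_n$. **Scheme.** A solution of the backward Euler–LDG scheme is a family $(w_p^{(n)},w_q^{(n)},\sigma_p^{(n)},\sigma_q^{(n)})_{n=1}^{N_t}$ in $\mathcal W^2\times\mathcal R^2$ such that, for $n=0,\dots,N_t-1$ and $\star=p,q$, with $z_\star^{(n+1)}=-\nabla_{\rm LDG}w_\star^{(n+1)}$ and $r_\star^{(n+1)}=\Pi_{\mathcal R}(D\sigma_\star^{(n+1)})$, $$(D\,s_\star''(u_\star(w_\star^{(n+1)}))\,\sigma_\star^{(n+1)},\phi)_\Omega=(Dz_\star^{(n+1)},\phi)_\Omega\qquad\forall\phi\in\mathcal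 R,$$ $$\varepsilon(w_\star^{(n+1)},\psi)_{\rm LDG}+\tfrac1{\tau_{n+1}}(u_\star(w_\star^{(n+1)})-u_{\star}^{(n)},\psi)_\Omega+({\rm div}_{\rm LDG}r_\star^{(n+1)},\psi)_\Omega+\sum_{F\in\mathcal F_h^{\mathcal I}}(\eta_F\mathsf h^{-1}[\![w_\star^{(n+1)}]\!]_N,[\![\psi]\!]_N)_F$$ $$=(f_\star(u_p(w_p^{(n+1)}),u_q(w_q^{(n+1)})),\psi)_\Omega\qquad\forall\psi\in\mathcal W,$$ where $u_p^{(0)}=\Pi_{\mathcal W}p_0$, $u_q^{(0)}=\Pi_{\mathcal W}q_0$ and $u_\star^{(n)}=\Pi_{\mathcal W}u_\star(w_\star^{(n)})$ for $n\ge1$. **Theorem (discrete entropy stability).** Let the data above (including $\ell,\eta_0,C_{\rm coer},C_{\rm Sob}$) and a constant $C_{\rm qu}>0$ be given. There is a constant $C>0$, independent of the space mesh (in particular of $h$), of the time mesh (in particular of $\tau$), of $\varepsilon$, and of the remaining discretization choices, such that the following holds. If the time mesh is quasi-uniform, $\tau\le C_{\rm qu}\tau_n$ for $n=1,\dots,N_t$,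 and $\tau<1/(2C_f)$, then every solution of the scheme satisfies, for $n=0,\dots,N_t-1$, $$C_{\rm coer}\,\varepsilon\tau_{n+1}\sum_{\star=p,q}\|w_\star^{(n+1)}\|_{\rm DG}^2+\sum_{\star=p,q}\int_\Omega s_\star(u_\star(w_\star^{(n+1)}))\,dx+4\mathcal E_p^{-1}d_{\rm upd}\tau_{n+1}\|\sigma_p^{(n+1)}\|_{L^2(\Omega)^d}^2$$ $$+\mathcal E_q^{-1}d_{\rm upd}\tau_{n+1}\exp\!\big(-C/\sqrt{\varepsilon\tau_{n+1}}\big)\|\sigma_q^{(n+1)}\|_{L^2(\Omega)^d}^2+\tau_{n+1}\sum_{\star=p,q}\|\eta_F^{1/2}\mathsf h^{-1/2}[\![w_\star^{(n+1)}]\!]_N\|_{L^2(\mathcal F_h^{\mathcal I})^d}^2$$ $$\le\sum_{\star=p,q}\int_\Omega s_\star(u_\star(w_\star^{(n)}))\,dx+C_f\tau_{n+1}\big(\mathcal E_q|\Omega|+C^*\big),$$ where for $n=0$ the terms $u_p(w_p^{(0)})$, $u_q(w_q^{(0)})$ are to be read as $p_0$, $q_0$, and $$\sum_{n=0}^{N_t-1}\tau_{n+1}\Big(C_{\rm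 coer}\,\varepsilon\sum_{\star=p,q}\|w_\star^{(n+1)}\|_{\rm DG}^2+4\mathcal E_p^{-1}d_{\rm upd}\|\sigma_p^{(n+1)}\|_{L^2(\Omega)^d}^2+\mathcal E_q^{-1}d_{\rm upd}\exp\!\big(-C/\sqrt{\varepsilon\tau_{n+1}}\big)\|\sigma_q^{(n+1)}\|_{L^2(\Omega)^d}^2$$ $$+\sum_{\star=p,q}\|\eta_F^{1/2}\mathsf h^{-1/2}[\![w_\star^{(n+1)}]\!]_N\|_{L^2(\mathcal F_h^{\mathcal I})^d}^2\Big)+\sum_{\star=p,q}\int_\Omega s_\star(u_\star(w_\star^{(N_t)}))\,dx$$ $$\le\int_\Omega s_p(p_0)\,dx+\int_\Omega s_q(q_0)\,dx+C_fT\big(\mathcal E_q|\Omega|+C^*\big),$$ where $$C^*=\exp\!\big(\tfrac32C_fC_{\rm qu}T\big)\Big(\int_\Omega s_q(q_0)\,dx+2\mathcal E_q|\Omega|C_fT\Big).$$ -/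

import Mathlib

open MeasureTheory

namespace LDG

open scoped Topology RealInnerProductSpace

/-- The Euclidean space `ℝ^d`. -/
abbrev Pt (d : ℕ) : Type := EuclideanSpace ℝ (Fin d)

/-! ### The reaction-diffusion model -/

/-- Reaction coefficients `κ_p, λ_p, λ_q, μ_pq > 0` with `Υ_pq = κ_p μ_pq - λ_p λ_q > 0`. -/
structure Coeffs where
  κp : ℝ
  lp : ℝ
  lq : ℝ
  μpq : ℝ
  κp_pos : 0 < κp
  lp_pos : 0 < lp
  lq_pos : 0 < lq
  μpq_pos : 0 < μpq
  upsilon_pos : 0 < κp * μpq - lp * lq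

namespace Coeffs

variable (c : Coeffs)

/-- `Υ_pq`. -/
noncomputable def upsilon : ℝ := c.κp * c.μpq - c.lp * c.lq

/-- `𝓔_p = κ_p / λ_p`. -/
noncomputable def 𝓔p : ℝ := c.κp / c.lp

/-- `𝓔_q = Υ_pq / (λ_q μ_pq)`. -/
noncomputable def 𝓔q : ℝ := c.upsilon / (c.lq * c.μpq)

/-- The change of variables `u_p`. -/
noncomputable def up (w : ℝ) : ℝ := c.𝓔p * (Real.exp w / (1 + Real.exp w))

/-- The change of variables `u_q`. -/
noncomputable def uq (w : ℝ) : ℝ := c.𝓔q * Real.exp w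

/-- The entropy density `s_p` on `[0, 𝓔_p]` (with `0 log 0 = 0`). -/
noncomputable def sp (p : ℝ) : ℝ :=
  p * Real.log p + (c.𝓔p - p) * Real.log (c.𝓔p - p) + max (c.𝓔p * Real.log (2 * c.𝓔p⁻¹)) 0

/-- The entropy density `s_q` on `[0, ∞)` (with `0 log 0 = 0`). -/
noncomputable def sq (q : ℝ) : ℝ := q * (Real.log (c.𝓔q⁻¹ * q) - 1) + c.𝓔q

/-- The second derivative `s_p''` on `(0, 𝓔_p)`. -/
noncomputable def spDD (p : ℝ) : ℝ := 1 / (p * (1 - c.𝓔p⁻¹ * p))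

/-- The reaction term `f_p`. -/
noncomputable def fp (p q : ℝ) : ℝ := -p * (c.lp + c.μpq * q) + c.κp

/-- The reaction term `f_q`. -/
noncomputable def fq (p q : ℝ) : ℝ := -q * (c.lq - c.μpq * p)

/-- The constant `C_f`. -/
noncomputable def Cf : ℝ :=
  (1 + Real.log 2) / Real.log 2 * c.𝓔p * (c.lp / c.𝓔q + 2 * c.μpq)

end Coeffs

/-- The second derivative `s_q''` on `(0, ∞)`. -/
noncomputable def sqDD (q : ℝ) : ℝ := 1 / q

/-- Action of a matrix on a vector of `ℝ^d`. -/
noncomputable def mulV {d : ℕ} (A : Matrix (Fin d) (Fin d) ℝ) (v : Pt d) : Pt d :=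
  WithLp.toLp 2 (A.mulVec (fun i => v i))

/-- `D ∈ L^∞(Ω)^{d×d}` is symmetric and uniformly positive definite with constant `dupd`. -/
structure IsDiffusionTensor {d : ℕ} (Ω : Set (Pt d)) (D : Pt d → Matrix (Fin d) (Fin d) ℝ)
    (dupd : ℝ) : Prop where
  memLp : ∀ i j, MemLp (fun x => D x i j) ⊤ (volume.restrict Ω)
  symm : ∀ᵐ x ∂(volume.restrict Ω), (D x).IsSymm
  dupd_pos : 0 < dupd
  coercive : ∀ᵐ x ∂(volume.restrict Ω), ∀ z : Pt d, dupd * ‖z‖ ^ 2 ≤ ⟪z, mulV (D x) z⟫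

/-! ### Space meshes -/

/-- A finite conforming simplicial partition of `Ω ⊂ ℝ^d`: a finite simplicial complex, all of
whose faces belong to a `d`-simplex of the complex, and which fills the closure of `Ω`. -/
structure SimplicialMesh {d : ℕ} (Ω : Set (Pt d)) where
  complex : Geometry.SimplicialComplex ℝ (Pt d)
  finite_faces : complex.faces.Finite
  pure : ∀ s ∈ complex.faces, ∃ t ∈ complex.faces, s ⊆ t ∧ t.card = d + 1
  space_eq : complex.space = closure Ω
  interior_subset : ∀ s ∈ complex.faces, s.card = d + 1 →
    interior (convexHull ℝ (s : Set (Pt d))) ⊆ Ω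

namespace SimplicialMesh

variable {d : ℕ} {Ω : Set (Pt d)} (𝒯 : SimplicialMesh Ω)

/-- The elements of the mesh, given by their sets of `d + 1` vertices. -/
def Elem : Type := {K : Finset (Pt d) // K ∈ 𝒯.complex.faces ∧ K.card = d + 1}

/-- The internal facets, given by their sets of `d` vertices: the `(d-1)`-dimensional faces that
are shared by two distinct elements. -/
def IntFacet : Type := {F : Finset (Pt d) // F ∈ 𝒯.complex.faces ∧ F.card = d ∧
  ∃ K₁ K₂ : 𝒯.Elem, K₁ ≠ K₂ ∧ F ⊆ K₁.1 ∧ F ⊆ K₂.1}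

noncomputable instance : Fintype 𝒯.Elem :=
  haveI : Finite 𝒯.Elem := (𝒯.finite_faces.subset (fun _ h => h.1)).to_subtype
  Fintype.ofFinite _

noncomputable instance : Fintype 𝒯.IntFacet :=
  haveI : Finite 𝒯.IntFacet := (𝒯.finite_faces.subset (fun _ h => h.1)).to_subtype
  Fintype.ofFinite _

variable {𝒯}

/-- The closed simplex occupied by an element. -/
def Elem.carrier (K : 𝒯.Elem) : Set (Pt d) := convexHull ℝ (K.1 : Set (Pt d))

/-- The diameter `h_K`. -/
noncomputable def Elem.diam (K : 𝒯.Elem) : ℝ := Metric.diam K.carrier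

/-- The closed `(d-1)`-simplex occupied by an internal facet. -/
def IntFacet.carrier (F : 𝒯.IntFacet) : Set (Pt d) := convexHull ℝ (F.1 : Set (Pt d))

/-- The first element `K₁` sharing the facet. The numbering of the two elements is arbitrary;
exchanging them amounts to replacing the weight `γ_F` by `1 - γ_F`. -/
noncomputable def IntFacet.K₁ (F : 𝒯.IntFacet) : 𝒯.Elem := F.2.2.2.choose

/-- The second element `K₂` sharing the facet. -/
noncomputable def IntFacet.K₂ (F : 𝒯.IntFacet) : 𝒯.Elem := F.2.2.2.choose_spec.choose

/-- The unit normal to the facet `F` of `K` that points out of `K`: the component orthogonal to `F`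
of the vector from the barycentre of `K` to the barycentre of `F`, normalized. -/
noncomputable def normal (K : 𝒯.Elem) (F : 𝒯.IntFacet) : Pt d :=
  let y : Pt d := ((vectorSpan ℝ (F.1 : Set (Pt d)))ᗮ).starProjection
    (F.1.centroid ℝ id - K.1.centroid ℝ id)
  ‖y‖⁻¹ • y

/-- The mesh size function on `F`, `min {h_{K₁}, h_{K₂}}`. -/
noncomputable def IntFacet.h (F : 𝒯.IntFacet) : ℝ := min F.K₁.diam F.K₂.diam

/-- Integral over an internal facet with respect to the `(d-1)`-dimensional surface measure. -/
noncomputable def IntFacet.integral (F : 𝒯.IntFacet) (g : Pt d → ℝ) : ℝ :=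
  ∫ x in F.carrier, g x ∂μHE[d - 1]

/-! ### Broken polynomial spaces -/

variable (𝒯)

/-- The broken space `W^ℓ(𝒯) = ∏_K P_ℓ(K)`. -/
abbrev W (ℓ : ℕ) : Type := 𝒯.Elem → MvPolynomial.restrictTotalDegree (Fin d) ℝ ℓ

/-- The broken vector space `R^ℓ(𝒯) = ∏_K P_ℓ(K)^d`. -/
abbrev R (ℓ : ℕ) : Type := 𝒯.Elem → Fin d → MvPolynomial.restrictTotalDegree (Fin d) ℝ ℓ

variable {𝒯} {ℓ : ℕ}

/-- The value at `x` of a polynomial in `d` variables. -/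
noncomputable def evalAt (x : Pt d) (P : MvPolynomial (Fin d) ℝ) : ℝ :=
  MvPolynomial.eval (fun i => x i) P

/-- The piecewise polynomial function defined by a family of polynomials, one for each element
(it is set to zero on the skeleton of the mesh, which is a null set). -/
noncomputable def glue (P : 𝒯.Elem → MvPolynomial (Fin d) ℝ) (x : Pt d) : ℝ :=
  ∑ K : 𝒯.Elem, (interior K.carrier).indicator (fun y => evalAt y (P K)) x

/-- The function on `Ω` represented by an element of `W^ℓ(𝒯)`. -/
noncomputable def valW (v : 𝒯.W ℓ) (x : Pt d) : ℝ := glue (fun K => (v K : MvPolynomial (Fin d) ℝ)) x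

/-- The vector field on `Ω` represented by an element of `R^ℓ(𝒯)`. -/
noncomputable def valR (φ : 𝒯.R ℓ) (x : Pt d) : Pt d :=
  WithLp.toLp 2 (fun i => glue (fun K => (φ K i : MvPolynomial (Fin d) ℝ)) x)

/-- The elementwise gradient `∇_h v`. -/
noncomputable def gradH (v : 𝒯.W ℓ) (x : Pt d) : Pt d :=
  WithLp.toLp 2 (fun i => glue (fun K => MvPolynomial.pderiv i (v K : MvPolynomial (Fin d) ℝ)) x)

/-- The value at a point of `K` (also on its boundary) of the restriction to `K` of
an element of `R^ℓ(𝒯)`. -/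
noncomputable def traceR (φ : 𝒯.R ℓ) (K : 𝒯.Elem) (x : Pt d) : Pt d :=
  WithLp.toLp 2 (fun i => evalAt x (φ K i : MvPolynomial (Fin d) ℝ))

/-- The normal jump of a scalar function across `F`. -/
noncomputable def jump (v : 𝒯.W ℓ) (F : 𝒯.IntFacet) (x : Pt d) : Pt d :=
  evalAt x (v F.K₁ : MvPolynomial (Fin d) ℝ) • normal F.K₁ F
    + evalAt x (v F.K₂ : MvPolynomial (Fin d) ℝ) • normal F.K₂ F

/-- The weighted mean value, with weight `1 - γ_F`, of a vector-valued function on `F`. -/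
noncomputable def mean (γ : 𝒯.IntFacet → ℝ) (φ : 𝒯.R ℓ) (F : 𝒯.IntFacet) (x : Pt d) : Pt d :=
  γ F • traceR φ F.K₁ x + (1 - γ F) • traceR φ F.K₂ x

/-- The `L²(Ω)`-orthogonal projection onto `W^ℓ(𝒯)`. -/
noncomputable def projW (ℓ : ℕ) (f : Pt d → ℝ) : 𝒯.W ℓ :=
  Classical.epsilon fun g => ∀ ψ : 𝒯.W ℓ,
    ∫ x in Ω, valW g x * valW ψ x = ∫ x in Ω, f x * valW ψ x

/-- The `L²(Ω)^d`-orthogonal projection onto `R^ℓ(𝒯)`. -/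
noncomputable def projR (ℓ : ℕ) (f : Pt d → Pt d) : 𝒯.R ℓ :=
  Classical.epsilon fun g => ∀ φ : 𝒯.R ℓ,
    ∫ x in Ω, ⟪valR g x, valR φ x⟫ = ∫ x in Ω, ⟪f x, valR φ x⟫

/-- The jump lifting operator `L : W^ℓ(𝒯) → R^ℓ(𝒯)`. -/
noncomputable def lifting (γ : 𝒯.IntFacet → ℝ) (v : 𝒯.W ℓ) : 𝒯.R ℓ :=
  Classical.epsilon fun g => ∀ φ : 𝒯.R ℓ,
    ∫ x in Ω, ⟪valR g x, valR φ x⟫ = ∑ F : 𝒯.IntFacet, F.integral fun x => ⟪jump v F x, mean γ φ F x⟫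

/-- The discrete gradient operator `∇_LDG : W^ℓ(𝒯) → R^ℓ(𝒯)`. -/
noncomputable def gradLDG (γ : 𝒯.IntFacet → ℝ) (v : 𝒯.W ℓ) : 𝒯.R ℓ :=
  Classical.epsilon fun g => ∀ φ : 𝒯.R ℓ,
    ∫ x in Ω, ⟪valR g x, valR φ x⟫ = ∫ x in Ω, ⟪gradH v x - valR (lifting γ v) x, valR φ x⟫

/-- The discrete divergence operator `div_LDG : R^ℓ(𝒯) → W^ℓ(𝒯)`. -/
noncomputable def divLDG (γ : 𝒯.IntFacet → ℝ) (r : 𝒯.R ℓ) : 𝒯.W ℓ :=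
  Classical.epsilon fun g => ∀ ψ : 𝒯.W ℓ,
    ∫ x in Ω, valW g x * valW ψ x = -∫ x in Ω, ⟪valR r x, valR (gradLDG γ ψ) x⟫

/-! ### The discrete operators are well defined -/

theorem glue_add (P Q : 𝒯.Elem → MvPolynomial (Fin d) ℝ) (x : Pt d) :
    glue (fun K => P K + Q K) x = glue P x + glue Q x := by
  simp only [glue, ← Finset.sum_add_distrib]
  refine Finset.sum_congr rfl fun K _ => ?_
  by_cases h : x ∈ interior K.carrier <;> simp [h, evalAt]

theorem glue_smul (a : ℝ) (P : 𝒯.Elem → MvPolynomial (Fin d) ℝ) (x : Pt d) :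
    glue (fun K => a • P K) x = a * glue P x := by
  simp only [glue, Finset.mul_sum]
  refine Finset.sum_congr rfl fun K _ => ?_
  by_cases h : x ∈ interior K.carrier <;> simp [h, evalAt]

theorem continuous_evalAt (P : MvPolynomial (Fin d) ℝ) : Continuous fun x : Pt d => evalAt x P := by
  unfold evalAt
  exact (MvPolynomial.continuous_eval P).comp (by fun_prop)

theorem Elem.isCompact_carrier (K : 𝒯.Elem) : IsCompact K.carrier :=
  K.1.finite_toSet.isCompact_convexHull ℝ

theorem measurable_glue (P : 𝒯.Elem → MvPolynomial (Fin d) ℝ) : Measurable (glue P) := by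
  unfold glue
  refine Finset.measurable_sum _ fun K _ => ?_
  exact (continuous_evalAt (P K)).measurable.indicator isOpen_interior.measurableSet

theorem exists_bound_glue (P : 𝒯.Elem → MvPolynomial (Fin d) ℝ) :
    ∃ C, ∀ x, ‖glue P x‖ ≤ C := by
  have h : ∀ K : 𝒯.Elem, ∃ C, 0 ≤ C ∧ ∀ x ∈ K.carrier, ‖evalAt x (P K)‖ ≤ C := fun K => by
    obtain ⟨C, hC⟩ := K.isCompact_carrier.exists_bound_of_continuousOn
      (continuous_evalAt (P K)).continuousOn
    exact ⟨max C 0, le_max_right _ _, fun x hx => (hC x hx).trans (le_max_left _ _)⟩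
  choose C hC0 hC using h
  refine ⟨∑ K, C K, fun x => (norm_sum_le _ _).trans (Finset.sum_le_sum fun K _ => ?_)⟩
  by_cases hx : x ∈ interior K.carrier
  · simpa [hx] using hC K x (_root_.interior_subset hx)
  · simpa [hx] using hC0 K

theorem integrable_mul_glue {μ : Measure (Pt d)} {f : Pt d → ℝ} (hf : Integrable f μ)
    (P : 𝒯.Elem → MvPolynomial (Fin d) ℝ) : Integrable (fun x => f x * glue P x) μ := by
  obtain ⟨C, hC⟩ := exists_bound_glue P
  exact hf.mul_bdd (measurable_glue P).aestronglyMeasurable (ae_of_all _ hC)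

theorem integrable_glue (hΩ : Bornology.IsBounded Ω) (P : 𝒯.Elem → MvPolynomial (Fin d) ℝ) :
    Integrable (glue P) (volume.restrict Ω) := by
  obtain ⟨C, hC⟩ := exists_bound_glue P
  have : IsFiniteMeasure (volume.restrict Ω) := ⟨by simpa using hΩ.measure_lt_top⟩
  exact Integrable.of_bound (measurable_glue P).aestronglyMeasurable C (ae_of_all _ hC)

theorem Elem.interior_nonempty (K : 𝒯.Elem) : (interior K.carrier).Nonempty := by
  unfold Elem.carrier
  rw [interior_convexHull_nonempty_iff_affineSpan_eq_top]
  have := (𝒯.complex.indep K.2.1).affineSpan_eq_top_iff_card_eq_finrank_add_one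
  simpa [K.2.2] using this

theorem Elem.disjoint_interior {K K' : 𝒯.Elem} (h : K ≠ K') :
    Disjoint (interior K.carrier) (interior K'.carrier) := by
  classical
  rw [Set.disjoint_iff_inter_eq_empty, ← interior_inter, Set.eq_empty_iff_forall_notMem]
  intro x hx
  have h1 : K.carrier ∩ K'.carrier ⊆ convexHull ℝ ((K.1 ∩ K'.1 : Finset (Pt d)) : Set (Pt d)) := by
    have := 𝒯.complex.inter_subset_convexHull K.2.1 K'.2.1
    simpa [Elem.carrier] using this
  have h2 : (interior (convexHull ℝ ((K.1 ∩ K'.1 : Finset (Pt d)) : Set (Pt d)))).Nonempty :=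
    ⟨x, interior_mono h1 hx⟩
  rw [interior_convexHull_nonempty_iff_affineSpan_eq_top] at h2
  have hind : AffineIndependent ℝ ((↑) : (K.1 ∩ K'.1 : Finset (Pt d)) → Pt d) :=
    (𝒯.complex.indep K.2.1).mono (by simp)
  have h3 : (K.1 ∩ K'.1).card = d + 1 := by
    have := hind.affineSpan_eq_top_iff_card_eq_finrank_add_one.1 (by rw [Subtype.range_coe_subtype]; exact h2)
    simpa using this
  apply h
  apply Subtype.ext
  have e1 := Finset.eq_of_subset_of_card_le (Finset.inter_subset_left (s₁ := K.1) (s₂ := K'.1))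
    (by rw [h3, K.2.2])
  have e2 := Finset.eq_of_subset_of_card_le (Finset.inter_subset_right (s₁ := K.1) (s₂ := K'.1))
    (by rw [h3, K'.2.2])
  exact e1.symm.trans e2

theorem glue_of_mem (P : 𝒯.Elem → MvPolynomial (Fin d) ℝ) {K : 𝒯.Elem} {x : Pt d}
    (hx : x ∈ interior K.carrier) : glue P x = evalAt x (P K) := by
  unfold glue
  rw [Finset.sum_eq_single K]
  · simp [hx]
  · intro K' _ h
    have := Set.disjoint_right.1 (Elem.disjoint_interior h) hx
    simp [this]
  · simp

theorem eq_zero_of_evalAt {P : MvPolynomial (Fin d) ℝ} {U : Set (Pt d)} (hU : IsOpen U)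
    (hne : U.Nonempty) (h : ∀ x ∈ U, evalAt x P = 0) : P = 0 := by
  obtain ⟨a, ha⟩ := hne
  have hV : IsOpen ((fun y : Fin d → ℝ => (WithLp.toLp 2 y : Pt d)) ⁻¹' U) :=
    hU.preimage (PiLp.continuous_toLp 2 _)
  obtain ⟨ε, hε, hb⟩ := Metric.isOpen_iff.1 hV (fun i => a i) (by simpa using ha)
  refine MvPolynomial.funext_set (fun i => Metric.ball (a i) ε) (fun i => ?_) fun y hy => ?_
  · rw [Real.ball_eq_Ioo]
    exact Set.Ioo_infinite (by linarith)
  · have hy' : y ∈ Metric.ball (fun i => a i) ε := by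
      rw [ball_pi _ hε]; exact hy
    simpa [evalAt] using h _ (hb hy')

theorem eq_zero_of_integral_glue (hΩ : Bornology.IsBounded Ω) (P : 𝒯.Elem → MvPolynomial (Fin d) ℝ)
    (h : ∫ x in Ω, glue P x * glue P x = 0) (K : 𝒯.Elem) : P K = 0 := by
  have hi := integrable_mul_glue (integrable_glue hΩ P) P
  rw [integral_eq_zero_iff_of_nonneg (fun x => mul_self_nonneg _) hi] at h
  have hK : interior K.carrier ⊆ Ω := 𝒯.interior_subset K.1 K.2.1 K.2.2
  have h2 : (fun x => evalAt x (P K)) =ᵐ[volume.restrict (interior K.carrier)] fun _ => 0 := by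
    filter_upwards [ae_restrict_of_ae_restrict_of_subset hK h,
      ae_restrict_mem isOpen_interior.measurableSet] with x hx hm
    rw [← glue_of_mem P hm]
    simpa using hx
  have h3 := Measure.eqOn_open_of_ae_eq h2 isOpen_interior
    (continuous_evalAt _).continuousOn continuousOn_const
  exact eq_zero_of_evalAt isOpen_interior K.interior_nonempty h3

/-- Riesz representation in finite dimension. -/
theorem existsUnique_repr {X : Type*} [AddCommGroup X] [Module ℝ X] [FiniteDimensional ℝ X]
    (b : X →ₗ[ℝ] X →ₗ[ℝ] ℝ) (hb : ∀ v, b v v = 0 → v = 0) (f : X →ₗ[ℝ] ℝ) :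
    ∃! g, ∀ φ, b g φ = f φ := by
  have hinj : Function.Injective b := by
    rw [injective_iff_map_eq_zero]
    intro v hv
    exact hb v (by rw [hv]; rfl)
  have hsurj : Function.Surjective b :=
    (LinearMap.injective_iff_surjective_of_finrank_eq_finrank (Subspace.dual_finrank_eq).symm).1 hinj
  obtain ⟨g, rfl⟩ := hsurj f
  exact ⟨g, fun _ => rfl, fun g' hg' => hinj (LinearMap.ext hg')⟩

/-- The `L²(Ω)` inner product on `W^ℓ(𝒯)`. -/
noncomputable def innerW (hΩ : Bornology.IsBounded Ω) : 𝒯.W ℓ →ₗ[ℝ] 𝒯.W ℓ →ₗ[ℝ] ℝ :=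
  LinearMap.mk₂ ℝ (fun v w => ∫ x in Ω, valW v x * valW w x)
    (fun a b w => by
      unfold valW
      rw [← integral_add (integrable_mul_glue (integrable_glue hΩ _) _)
        (integrable_mul_glue (integrable_glue hΩ _) _)]
      refine integral_congr_ae (ae_of_all _ fun x => ?_)
      have := glue_add (fun K => (a K : MvPolynomial (Fin d) ℝ)) (fun K => b K) x
      simp only [Pi.add_apply, Submodule.coe_add, this]; ring)
    (fun r a w => by
      rw [smul_eq_mul, ← integral_const_mul]
      refine integral_congr_ae (ae_of_all _ fun x => ?_)
      have : valW (r • a) x = r * valW a x := glue_smul _ _ x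
      simp only [this]; ring)
    (fun w a b => by
      unfold valW
      rw [← integral_add (integrable_mul_glue (integrable_glue hΩ _) _)
        (integrable_mul_glue (integrable_glue hΩ _) _)]
      refine integral_congr_ae (ae_of_all _ fun x => ?_)
      have := glue_add (fun K => (a K : MvPolynomial (Fin d) ℝ)) (fun K => b K) x
      simp only [Pi.add_apply, Submodule.coe_add, this]; ring)
    (fun r w a => by
      rw [smul_eq_mul, ← integral_const_mul]
      refine integral_congr_ae (ae_of_all _ fun x => ?_)
      have : valW (r • a) x = r * valW a x := glue_smul _ _ x
      simp only [this]; ring)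

theorem existsUnique_W (hΩ : Bornology.IsBounded Ω) (f : 𝒯.W ℓ →ₗ[ℝ] ℝ) :
    ∃! g : 𝒯.W ℓ, ∀ ψ : 𝒯.W ℓ, ∫ x in Ω, valW g x * valW ψ x = f ψ := by
  refine existsUnique_repr (innerW hΩ) (fun v hv => ?_) f
  funext K
  exact Subtype.ext (eq_zero_of_integral_glue hΩ _ hv K)

theorem valR_add (a b : 𝒯.R ℓ) (x : Pt d) : valR (a + b) x = valR a x + valR b x := by
  ext i
  exact glue_add (fun K => (a K i : MvPolynomial (Fin d) ℝ)) (fun K => b K i) x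

theorem valR_smul (r : ℝ) (a : 𝒯.R ℓ) (x : Pt d) : valR (r • a) x = r • valR a x := by
  ext i
  exact glue_smul r (fun K => (a K i : MvPolynomial (Fin d) ℝ)) x

theorem integrable_inner_valR {μ : Measure (Pt d)} {f : Pt d → Pt d}
    (hf : ∀ i, Integrable (fun x => f x i) μ) (φ : 𝒯.R ℓ) :
    Integrable (fun x => ⟪f x, valR φ x⟫) μ := by
  have : (fun x => ⟪f x, valR φ x⟫) = fun x => ∑ i, f x i * valR φ x i := by
    funext x
    simp [PiLp.inner_apply, mul_comm]
  rw [this]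
  exact integrable_finsetSum _ fun i _ => integrable_mul_glue (hf i) _

theorem integrable_valR (hΩ : Bornology.IsBounded Ω) (φ : 𝒯.R ℓ) (i : Fin d) :
    Integrable (fun x => valR φ x i) (volume.restrict Ω) := integrable_glue hΩ _

/-- The functional `φ ↦ (f, φ)_Ω` on `R^ℓ(𝒯)`, for an integrable field `f`. -/
noncomputable def pairR (f : Pt d → Pt d)
    (hf : ∀ i, Integrable (fun x => f x i) (volume.restrict Ω)) : 𝒯.R ℓ →ₗ[ℝ] ℝ where
  toFun φ := ∫ x in Ω, ⟪f x, valR φ x⟫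
  map_add' a b := by
    simp only [valR_add, inner_add_right]
    exact integral_add (integrable_inner_valR hf a) (integrable_inner_valR hf b)
  map_smul' r a := by
    simp only [valR_smul, inner_smul_right, integral_const_mul]
    rfl

theorem existsUnique_R (hΩ : Bornology.IsBounded Ω) (f : 𝒯.R ℓ →ₗ[ℝ] ℝ) :
    ∃! g : 𝒯.R ℓ, ∀ φ : 𝒯.R ℓ, ∫ x in Ω, ⟪valR g x, valR φ x⟫ = f φ := by
  have hc : ∀ a b : 𝒯.R ℓ, ∫ x in Ω, ⟪valR a x, valR b x⟫ = ∫ x in Ω, ⟪valR b x, valR a x⟫ :=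
    fun a b => integral_congr_ae (ae_of_all _ fun x => real_inner_comm _ _)
  let b : 𝒯.R ℓ →ₗ[ℝ] 𝒯.R ℓ →ₗ[ℝ] ℝ :=
    { toFun := fun g => pairR (valR g) (integrable_valR hΩ g)
      map_add' := fun a a' => LinearMap.ext fun φ => by
        change ∫ x in Ω, ⟪valR (a + a') x, valR φ x⟫
          = (∫ x in Ω, ⟪valR a x, valR φ x⟫) + ∫ x in Ω, ⟪valR a' x, valR φ x⟫
        rw [hc _ φ, hc _ φ, hc _ φ]
        exact (pairR (valR φ) (integrable_valR hΩ φ)).map_add a a'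
      map_smul' := fun r a => LinearMap.ext fun φ => by
        change ∫ x in Ω, ⟪valR (r • a) x, valR φ x⟫ = r * ∫ x in Ω, ⟪valR a x, valR φ x⟫
        rw [hc _ φ, hc _ φ]
        exact (pairR (valR φ) (integrable_valR hΩ φ)).map_smul r a }
  refine existsUnique_repr b (fun v hv => ?_) f
  have hv' : ∫ x in Ω, ⟪valR v x, valR v x⟫ = 0 := hv
  rw [integral_eq_zero_iff_of_nonneg (fun x => (real_inner_self_nonneg : 0 ≤ ⟪valR v x, valR v x⟫))
    (integrable_inner_valR (integrable_valR hΩ v) v)] at hv'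
  funext K i
  refine Subtype.ext (eq_zero_of_integral_glue hΩ (fun K => (v K i : MvPolynomial (Fin d) ℝ)) ?_ K)
  refine integral_eq_zero_of_ae ?_
  filter_upwards [hv'] with x hx
  have h0 : valR v x = 0 := by simpa using hx
  have hi : valR v x i = 0 := by rw [h0]; rfl
  have hg : glue (fun K => (v K i : MvPolynomial (Fin d) ℝ)) x = 0 := hi
  simp [hg]

theorem measure_facet_lt_top (F : 𝒯.IntFacet) : (μHE[d - 1] : Measure (Pt d)) F.carrier < ⊤ := by
  obtain ⟨p, hp⟩ := 𝒯.complex.nonempty_of_mem_faces F.2.1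
  let S := vectorSpan ℝ (F.1 : Set (Pt d))
  have hfin : Module.finrank ℝ S = d - 1 := by
    have hd : d ≠ 0 := by
      rintro h
      have := F.2.2.1.trans h
      rw [Finset.card_eq_zero] at this
      rw [this] at hp
      simp at hp
    have := (𝒯.complex.indep F.2.1).finrank_vectorSpan (n := d - 1)
      (by simpa using F.2.2.1.trans (by omega))
    rw [Subtype.range_coe_subtype] at this
    exact this
  have hiso : Isometry fun y : S => p + (y : Pt d) :=
    (isometry_add_left p).comp isometry_subtype_coe
  have hsub : F.carrier ⊆ Set.range fun y : S => p + (y : Pt d) := by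
    intro x hx
    have h1 := convexHull_subset_affineSpan (𝕜 := ℝ) _ hx
    have h2 := AffineSubspace.vsub_mem_direction h1 (subset_affineSpan ℝ (F.1 : Set (Pt d)) hp)
    rw [direction_affineSpan] at h2
    exact ⟨⟨x - p, h2⟩, by simp⟩
  have hpre := hiso.euclideanHausdorffMeasure_preimage (d := d - 1) F.carrier
  rw [Set.inter_eq_left.2 hsub] at hpre
  rw [← hpre, ← hfin, InnerProductSpace.euclideanHausdorffMeasure_eq_volume]
  refine Bornology.IsBounded.measure_lt_top ?_
  exact hiso.antilipschitz.isBounded_preimage (F.1.finite_toSet.isCompact_convexHull ℝ).isBounded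

theorem continuous_traceR (φ : 𝒯.R ℓ) (K : 𝒯.Elem) : Continuous (traceR φ K) := by
  refine (PiLp.continuous_toLp 2 _).comp (continuous_pi fun i => continuous_evalAt _)

theorem continuous_jump (v : 𝒯.W ℓ) (F : 𝒯.IntFacet) : Continuous (jump v F) :=
  ((continuous_evalAt _).smul continuous_const).add ((continuous_evalAt _).smul continuous_const)

theorem continuous_mean (γ : 𝒯.IntFacet → ℝ) (φ : 𝒯.R ℓ) (F : 𝒯.IntFacet) :
    Continuous (mean γ φ F) :=
  ((continuous_traceR φ F.K₁).const_smul (γ F)).add ((continuous_traceR φ F.K₂).const_smul (1 - γ F))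

theorem integrableOn_facet (F : 𝒯.IntFacet) {g : Pt d → ℝ} (hg : Continuous g) :
    IntegrableOn g F.carrier μHE[d - 1] := by
  have hK : IsCompact F.carrier := F.1.finite_toSet.isCompact_convexHull ℝ
  have : IsFiniteMeasure ((μHE[d - 1] : Measure (Pt d)).restrict F.carrier) :=
    ⟨by simpa using measure_facet_lt_top F⟩
  obtain ⟨C, hC⟩ := hK.exists_bound_of_continuousOn hg.continuousOn
  exact Integrable.of_bound hg.aestronglyMeasurable C
    ((ae_restrict_mem hK.measurableSet).mono fun x hx => hC x hx)

theorem mean_add (γ : 𝒯.IntFacet → ℝ) (a b : 𝒯.R ℓ) (F : 𝒯.IntFacet) (x : Pt d) :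
    mean γ (a + b) F x = mean γ a F x + mean γ b F x := by
  ext i
  simp [mean, traceR, evalAt]
  ring

theorem mean_smul (γ : 𝒯.IntFacet → ℝ) (r : ℝ) (a : 𝒯.R ℓ) (F : 𝒯.IntFacet) (x : Pt d) :
    mean γ (r • a) F x = r • mean γ a F x := by
  ext i
  simp [mean, traceR, evalAt]
  ring

theorem jump_add (a b : 𝒯.W ℓ) (F : 𝒯.IntFacet) (x : Pt d) :
    jump (a + b) F x = jump a F x + jump b F x := by
  simp only [jump, evalAt, Pi.add_apply, Submodule.coe_add, map_add, add_smul]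
  abel

theorem jump_smul (r : ℝ) (a : 𝒯.W ℓ) (F : 𝒯.IntFacet) (x : Pt d) :
    jump (r • a) F x = r • jump a F x := by
  simp [jump, evalAt, mul_smul]

/-- The bilinear form `∑_F (⟦v⟧, mean φ)_F`. -/
noncomputable def facetForm (γ : 𝒯.IntFacet → ℝ) : 𝒯.W ℓ →ₗ[ℝ] 𝒯.R ℓ →ₗ[ℝ] ℝ :=
  have hint : ∀ (v : 𝒯.W ℓ) (φ : 𝒯.R ℓ) (F : 𝒯.IntFacet),
      IntegrableOn (fun x => ⟪jump v F x, mean γ φ F x⟫) F.carrier μHE[d - 1] := fun v φ F =>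
    integrableOn_facet F ((continuous_jump v F).inner (continuous_mean γ φ F))
  LinearMap.mk₂ ℝ (fun v φ => ∑ F : 𝒯.IntFacet, F.integral fun x => ⟪jump v F x, mean γ φ F x⟫)
    (fun a b φ => by
      rw [← Finset.sum_add_distrib]
      refine Finset.sum_congr rfl fun F _ => ?_
      simp only [jump_add, inner_add_left]
      exact integral_add (hint a φ F) (hint b φ F))
    (fun r a φ => by
      rw [smul_eq_mul, Finset.mul_sum]
      refine Finset.sum_congr rfl fun F _ => ?_
      simp only [jump_smul, real_inner_smul_left]
      exact integral_const_mul _ _)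
    (fun v a b => by
      rw [← Finset.sum_add_distrib]
      refine Finset.sum_congr rfl fun F _ => ?_
      simp only [mean_add, inner_add_right]
      exact integral_add (hint v a F) (hint v b F))
    (fun r v a => by
      rw [smul_eq_mul, Finset.mul_sum]
      refine Finset.sum_congr rfl fun F _ => ?_
      simp only [mean_smul, real_inner_smul_right]
      exact integral_const_mul _ _)

theorem projW_spec (hΩ : Bornology.IsBounded Ω) {f : Pt d → ℝ}
    (hf : Integrable f (volume.restrict Ω)) (ψ : 𝒯.W ℓ) :
    ∫ x in Ω, valW (projW (𝒯 := 𝒯) ℓ f) x * valW ψ x = ∫ x in Ω, f x * valW ψ x := by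
  let L : 𝒯.W ℓ →ₗ[ℝ] ℝ :=
    { toFun := fun ψ => ∫ x in Ω, f x * valW ψ x
      map_add' := fun a b => by
        unfold valW
        rw [← integral_add (integrable_mul_glue hf _) (integrable_mul_glue hf _)]
        refine integral_congr_ae (ae_of_all _ fun x => ?_)
        have := glue_add (fun K => (a K : MvPolynomial (Fin d) ℝ)) (fun K => b K) x
        simp only [Pi.add_apply, Submodule.coe_add, this]; ring
      map_smul' := fun r a => by
        rw [RingHom.id_apply, smul_eq_mul, ← integral_const_mul]
        refine integral_congr_ae (ae_of_all _ fun x => ?_)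
        have : valW (r • a) x = r * valW a x := glue_smul _ _ x
        simp only [this]; ring }
  exact Classical.epsilon_spec (existsUnique_W hΩ L).exists ψ

theorem projR_spec (hΩ : Bornology.IsBounded Ω) {f : Pt d → Pt d}
    (hf : ∀ i, Integrable (fun x => f x i) (volume.restrict Ω)) (φ : 𝒯.R ℓ) :
    ∫ x in Ω, ⟪valR (projR (𝒯 := 𝒯) ℓ f) x, valR φ x⟫ = ∫ x in Ω, ⟪f x, valR φ x⟫ :=
  Classical.epsilon_spec (existsUnique_R hΩ (pairR f hf)).exists φ

theorem lifting_spec (hΩ : Bornology.IsBounded Ω) (γ : 𝒯.IntFacet → ℝ) (v : 𝒯.W ℓ) (φ : 𝒯.R ℓ) :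
    ∫ x in Ω, ⟪valR (lifting γ v) x, valR φ x⟫
      = ∑ F : 𝒯.IntFacet, F.integral fun x => ⟪jump v F x, mean γ φ F x⟫ :=
  Classical.epsilon_spec (existsUnique_R hΩ (facetForm γ v)).exists φ

theorem integrable_gradH (hΩ : Bornology.IsBounded Ω) (v : 𝒯.W ℓ) (i : Fin d) :
    Integrable (fun x => gradH v x i) (volume.restrict Ω) := integrable_glue hΩ _

theorem gradLDG_spec (hΩ : Bornology.IsBounded Ω) (γ : 𝒯.IntFacet → ℝ) (v : 𝒯.W ℓ) (φ : 𝒯.R ℓ) :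
    ∫ x in Ω, ⟪valR (gradLDG γ v) x, valR φ x⟫
      = ∫ x in Ω, ⟪gradH v x - valR (lifting γ v) x, valR φ x⟫ :=
  Classical.epsilon_spec (existsUnique_R hΩ (pairR (fun x => gradH v x - valR (lifting γ v) x)
    fun i => (integrable_gradH hΩ v i).sub (integrable_valR hΩ _ i))).exists φ

/-- `(∇_LDG v, φ)_Ω = (∇_h v, φ)_Ω - ∑_F (⟦v⟧, mean φ)_F`. -/
theorem gradLDG_spec' (hΩ : Bornology.IsBounded Ω) (γ : 𝒯.IntFacet → ℝ) (v : 𝒯.W ℓ) (φ : 𝒯.R ℓ) :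
    ∫ x in Ω, ⟪valR (gradLDG γ v) x, valR φ x⟫
      = (∫ x in Ω, ⟪gradH v x, valR φ x⟫) - facetForm γ v φ := by
  rw [gradLDG_spec hΩ]
  simp only [inner_sub_left]
  rw [integral_sub (integrable_inner_valR (integrable_gradH hΩ v) φ)
    (integrable_inner_valR (integrable_valR hΩ _) φ), lifting_spec hΩ]
  rfl

theorem gradH_add (a b : 𝒯.W ℓ) (x : Pt d) : gradH (a + b) x = gradH a x + gradH b x := by
  ext i
  have := glue_add (fun K => MvPolynomial.pderiv i (a K : MvPolynomial (Fin d) ℝ))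
    (fun K => MvPolynomial.pderiv i (b K : MvPolynomial (Fin d) ℝ)) x
  simpa [gradH] using this

theorem gradH_smul (r : ℝ) (a : 𝒯.W ℓ) (x : Pt d) : gradH (r • a) x = r • gradH a x := by
  ext i
  have := glue_smul r (fun K => MvPolynomial.pderiv i (a K : MvPolynomial (Fin d) ℝ)) x
  simpa [gradH] using this

theorem divLDG_spec (hΩ : Bornology.IsBounded Ω) (γ : 𝒯.IntFacet → ℝ) (r : 𝒯.R ℓ) (ψ : 𝒯.W ℓ) :
    ∫ x in Ω, valW (divLDG γ r) x * valW ψ x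
      = -∫ x in Ω, ⟪valR r x, valR (gradLDG γ ψ) x⟫ := by
  have key : ∀ ψ : 𝒯.W ℓ, ∫ x in Ω, ⟪valR r x, valR (gradLDG γ ψ) x⟫
      = (∫ x in Ω, ⟪gradH ψ x, valR r x⟫) - facetForm γ ψ r := fun ψ => by
    rw [← gradLDG_spec' hΩ]
    exact integral_congr_ae (ae_of_all _ fun x => real_inner_comm _ _)
  let L : 𝒯.W ℓ →ₗ[ℝ] ℝ :=
    { toFun := fun ψ => -∫ x in Ω, ⟪valR r x, valR (gradLDG γ ψ) x⟫
      map_add' := fun a b => by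
        simp only [key, gradH_add, inner_add_left, map_add, LinearMap.add_apply]
        rw [integral_add (integrable_inner_valR (integrable_gradH hΩ a) r)
          (integrable_inner_valR (integrable_gradH hΩ b) r)]
        ring
      map_smul' := fun t a => by
        simp only [key, gradH_smul, real_inner_smul_left, map_smul, LinearMap.smul_apply,
          integral_const_mul, smul_eq_mul, RingHom.id_apply]
        ring }
  exact Classical.epsilon_spec (existsUnique_W hΩ L).exists ψ

/-! ### Stability parameters and norms -/

/-- The trace on `F` from `K` of the function `n_K · D n_K`: the (upper) limit at `x` of its means
over `K ∩ B(x, r)` as `r → 0`. It is the usual trace whenever that exists, for instance if `D` is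
continuous up to the boundary of `K`. -/
noncomputable def normalDiffusion (D : Pt d → Matrix (Fin d) (Fin d) ℝ) (K : 𝒯.Elem)
    (F : 𝒯.IntFacet) (x : Pt d) : ℝ :=
  Filter.limsup (fun r : ℝ => ⨍ y in Metric.ball x r ∩ K.carrier,
    ⟪normal K F, mulV (D y) (normal K F)⟫) (𝓝[>] 0)

/-- The stability parameter `η_F`. -/
noncomputable def stabParam (D : Pt d → Matrix (Fin d) (Fin d) ℝ) (η₀ : ℝ) (ℓ : ℕ)
    (F : 𝒯.IntFacet) (x : Pt d) : ℝ :=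
  η₀ * (ℓ : ℝ) ^ 2 *
    (2 * normalDiffusion D F.K₁ F x * normalDiffusion D F.K₂ F x /
      (normalDiffusion D F.K₁ F x + normalDiffusion D F.K₂ F x))

/-- The jump form `∑_F (η_F h⁻¹ ⟦v⟧, ⟦ψ⟧)_F`. -/
noncomputable def jumpForm (D : Pt d → Matrix (Fin d) (Fin d) ℝ) (η₀ : ℝ) (v ψ : 𝒯.W ℓ) : ℝ :=
  ∑ F : 𝒯.IntFacet, F.integral fun x =>
    ⟪(stabParam D η₀ ℓ F x * F.h⁻¹) • jump v F x, jump ψ F x⟫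

/-- The squared norm `‖η_F^{1/2} h^{-1/2} ⟦v⟧‖²` in `L²(F_h^I)^d`. -/
noncomputable def jumpNormSq (D : Pt d → Matrix (Fin d) (Fin d) ℝ) (η₀ : ℝ) (v : 𝒯.W ℓ) : ℝ :=
  ∑ F : 𝒯.IntFacet, F.integral fun x =>
    ‖(Real.sqrt (stabParam D η₀ ℓ F x) * (Real.sqrt F.h)⁻¹) • jump v F x‖ ^ 2

/-- The squared norm `‖φ‖²` in `L²(Ω)^d`. -/
noncomputable def normSqR (φ : 𝒯.R ℓ) : ℝ := ∫ x in Ω, ‖valR φ x‖ ^ 2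

end SimplicialMesh

/-- An inner product `(·,·)_LDG` together with a norm `‖·‖_DG` on a real vector space. -/
structure LDGProduct (X : Type) [AddCommGroup X] [Module ℝ X] where
  form : X →ₗ[ℝ] X →ₗ[ℝ] ℝ
  form_symm : ∀ v w, form v w = form w v
  form_pos : ∀ v, v ≠ 0 → 0 < form v v
  dgNorm : Seminorm ℝ X
  dgNorm_pos : ∀ v, v ≠ 0 → 0 < dgNorm v

/-! ### Time meshes -/

/-- A partition `0 = t_0 < t_1 < … < t_N = T` of the time interval. -/
structure TimeMesh (T : ℝ) where
  N : ℕ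
  t : ℕ → ℝ
  t_zero : t 0 = 0
  t_last : t N = T
  t_lt : ∀ n < N, t n < t (n + 1)

namespace TimeMesh

variable {T : ℝ} (𝒥 : TimeMesh T)

/-- The time step `τ_{n+1} = t_{n+1} - t_n`. -/
noncomputable def step (n : ℕ) : ℝ := 𝒥.t (n + 1) - 𝒥.t n

/-- The mesh size `τ`, the largest time step. -/
noncomputable def size : ℝ := ⨆ n : Fin 𝒥.N, 𝒥.step n

/-- Quasi-uniformity with constant `Cqu`. -/
def IsQuasiUniform (Cqu : ℝ) : Prop := ∀ n < 𝒥.N, 𝒥.size ≤ Cqu * 𝒥.step n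

end TimeMesh

/-! ### The backward Euler-LDG scheme -/

section Scheme

open SimplicialMesh

variable {d : ℕ} {Ω : Set (Pt d)} {𝒯 : SimplicialMesh Ω} {ℓ : ℕ}

/-- One step of the scheme for one of the two species, with transformation `u`, second derivative
`sDD` of the entropy density, transmitted value `uOld` and reaction term `f`. -/
structure IsStep (D : Pt d → Matrix (Fin d) (Fin d) ℝ) (γ : 𝒯.IntFacet → ℝ) (η₀ : ℝ)
    (B : LDGProduct (𝒯.W ℓ)) (ε τ : ℝ) (u sDD : ℝ → ℝ) (uOld : 𝒯.W ℓ) (f : Pt d → ℝ)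
    (w : 𝒯.W ℓ) (z σ r : 𝒯.R ℓ) : Prop where
  z_eq : z = -gradLDG γ w
  σ_eq : ∀ φ : 𝒯.R ℓ,
    ∫ x in Ω, ⟪mulV (D x) (sDD (u (valW w x)) • valR σ x), valR φ x⟫
      = ∫ x in Ω, ⟪mulV (D x) (valR z x), valR φ x⟫
  r_eq : r = projR ℓ (fun x => mulV (D x) (valR σ x))
  w_eq : ∀ ψ : 𝒯.W ℓ,
    ε * B.form w ψ + 1 / τ * (∫ x in Ω, (u (valW w x) - valW uOld x) * valW ψ x)
      + (∫ x in Ω, valW (divLDG γ r) x * valW ψ x) + jumpForm D η₀ w ψ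
      = ∫ x in Ω, f x * valW ψ x

/-- The quantity transmitted from the previous time step: the projection of the initial datum `u₀`
if `n = 0`, the projection of `u(w^n)` otherwise. -/
noncomputable def transmitted (u : ℝ → ℝ) (u₀ : Pt d → ℝ) (w : ℕ → 𝒯.W ℓ) (n : ℕ) : 𝒯.W ℓ :=
  if n = 0 then projW ℓ u₀ else projW ℓ (fun x => u (valW (w n) x))

/-- `(w_p^n, w_q^n, σ_p^n, σ_q^n)`, `n = 1, …, N`, is a solution of the backward Euler-LDG scheme
(the values of the sequences at the other indices play no role). -/
def IsSolution {T : ℝ} (c : Coeffs) (D : Pt d → Matrix (Fin d) (Fin d) ℝ) (p₀ q₀ : Pt d → ℝ)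
    (γ : 𝒯.IntFacet → ℝ) (η₀ : ℝ) (B : LDGProduct (𝒯.W ℓ)) (ε : ℝ) (𝒥 : TimeMesh T)
    (wp wq : ℕ → 𝒯.W ℓ) (σp σq : ℕ → 𝒯.R ℓ) : Prop :=
  ∀ n < 𝒥.N,
    (∃ z r : 𝒯.R ℓ, IsStep D γ η₀ B ε (𝒥.step n) c.up c.spDD (transmitted c.up p₀ wp n)
      (fun x => c.fp (c.up (valW (wp (n + 1)) x)) (c.uq (valW (wq (n + 1)) x)))
      (wp (n + 1)) z (σp (n + 1)) r) ∧
    (∃ z r : 𝒯.R ℓ, IsStep D γ η₀ B ε (𝒥.step n) c.uq sqDD (transmitted c.uq q₀ wq n)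
      (fun x => c.fq (c.up (valW (wp (n + 1)) x)) (c.uq (valW (wq (n + 1)) x)))
      (wq (n + 1)) z (σq (n + 1)) r)

/-- The entropy `∫_Ω s(u(w^n))` at time `t_n`, with `u(w^0)` understood as the initial datum `u₀`. -/
noncomputable def entropyAt (s u : ℝ → ℝ) (u₀ : Pt d → ℝ) (w : ℕ → 𝒯.W ℓ) (n : ℕ) : ℝ :=
  if n = 0 then ∫ x in Ω, s (u₀ x) else ∫ x in Ω, s (u (valW (w n) x))

end Scheme

/-- The constant `C*`. -/
noncomputable def Cstar {d : ℕ} (Ω : Set (Pt d)) (c : Coeffs) (q₀ : Pt d → ℝ) (Cqu T : ℝ) : ℝ :=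
  Real.exp (3 / 2 * c.Cf * Cqu * T)
    * ((∫ x in Ω, c.sq (q₀ x)) + 2 * c.𝓔q * volume.real Ω * c.Cf * T)

end LDG

/-!
The change of variables is made so that `w` is the derivative of the entropy density at `u(w)`. Testing
the scheme with `ψ = w` therefore turns the discrete time derivative into a difference of entropies,
because a convex function lies above its tangents (`Coeffs.sp_up_sub_le`, `Coeffs.sq_uq_sub_le`; the
`L²` projection of the previous value is invisible to polynomial test functions). The diffusion term
becomes `(D s''(u(w)) σ, σ)` by the definitions of `div_LDG`, `r` and `σ` and by the symmetry of `D`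
(`diffusion_ge`), and the penalty term is the jump norm, since the stability parameter is nonnegative
(`jumpForm_self`). `IsStep.entropy_le` collects these facts.

For the reaction, `f_p w_p + f_q w_q` and `f_q w_q` are both bounded by `C_f (𝓔_q + s_q(u_q))`
(`Coeffs.reaction_le`, `Coeffs.reaction_q_le`). The second bound closes an inequality for the entropy
of `q` alone, and the discrete Gronwall inequality (`TimeMesh.gronwall'`) bounds that entropy by `C*`;
the first bound then gives the inequality for both species.

While `s_p'' ≥ 4 / 𝓔_p` everywhere, `s_q''(u_q(w)) = 𝓔_q⁻¹ e^{-w}` is only bounded below in terms of an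
upper bound for `w`. Such a bound comes from the regularization: the inequality for `q` alone bounds
`ε τ ‖w_q‖²` in the DG norm by data (`IsSolution.dgNorm_q_le`), and the assumed discrete Sobolev
inequality turns this into `w_q ≤ C / √(ε τ)`. The estimate over all time steps follows by summation.
-/

namespace LDG

open scoped Topology RealInnerProductSpace

/-! ### Entropy densities and reaction terms -/

/-- Nonnegativity of the relative entropy density `v log (v / u) - v + u`. -/
theorem sub_le_mul_log_sub_mul_log {u v : ℝ} (hu : 0 < u) (hv : 0 ≤ v) :
    v - u ≤ v * Real.log v - v * Real.log u := by
  rcases hv.eq_or_lt with rfl | hv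
  · simpa using hu.le
  · have h := mul_le_mul_of_nonneg_left (Real.log_le_sub_one_of_pos (div_pos hu hv)) hv.le
    rw [Real.log_div hu.ne' hv.ne', mul_sub, mul_sub, mul_div_cancel₀ _ hv.ne'] at h
    linarith

theorem neg_one_le_mul_exp (w : ℝ) : -1 ≤ w * Real.exp w := by
  have h := mul_le_mul_of_nonneg_right (Real.add_one_le_exp (-w)) (Real.exp_pos w).le
  rw [← Real.exp_add, neg_add_cancel, Real.exp_zero] at h
  nlinarith [Real.exp_pos w]

/-- The minimum of `e^w (w - 5/3)` is `-e^{2/3} > -2`. -/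
theorem exp_mul_sub_add_two_nonneg (w : ℝ) : 0 ≤ Real.exp w * (w - 5 / 3) + 2 := by
  have h := sub_le_mul_log_sub_mul_log (Real.exp_pos (2 / 3)) (Real.exp_pos w).le
  rw [Real.log_exp, Real.log_exp] at h
  have h2 : Real.exp (2 / 3) ≤ 2 := by
    rw [← Real.le_log_iff_exp_le two_pos]
    linarith [Real.log_two_gt_d9]
  linarith

namespace Coeffs

variable (c : Coeffs)

theorem 𝓔p_pos : 0 < c.𝓔p := div_pos c.κp_pos c.lp_pos

theorem 𝓔q_pos : 0 < c.𝓔q := div_pos c.upsilon_pos (mul_pos c.lq_pos c.μpq_pos)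

theorem Cf_ge : 2 * c.𝓔p * (c.lp / c.𝓔q + 2 * c.μpq) ≤ c.Cf := by
  have h0 : 0 < Real.log 2 := Real.log_pos one_lt_two
  have h1 : 2 ≤ (1 + Real.log 2) / Real.log 2 := by
    rw [le_div_iff₀ h0]
    linarith [Real.log_two_lt_d9]
  have := c.𝓔p_pos
  have := c.𝓔q_pos
  have := c.lp_pos
  have := c.μpq_pos
  unfold Cf
  gcongr

theorem Cf_pos : 0 < c.Cf := by
  have := c.𝓔p_pos
  have := c.𝓔q_pos
  have := c.lp_pos
  have := c.μpq_pos
  exact lt_of_lt_of_le (by positivity) c.Cf_ge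

/-- The hypothesis `Υ_pq > 0` says that the birth rate of `q` can exceed its death rate. -/
theorem lq_le : c.lq ≤ c.μpq * c.𝓔p := by
  have := c.upsilon_pos
  rw [𝓔p, ← mul_div_assoc, le_div_iff₀ c.lp_pos]
  linarith

theorem up_pos (w : ℝ) : 0 < c.up w := by
  have := c.𝓔p_pos
  unfold up
  positivity

theorem 𝓔p_sub_up (w : ℝ) : c.𝓔p - c.up w = c.𝓔p / (1 + Real.exp w) := by
  unfold up
  have : 1 + Real.exp w ≠ 0 := by positivity
  field_simp
  ring

theorem 𝓔p_sub_up_pos (w : ℝ) : 0 < c.𝓔p - c.up w := by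
  have := c.𝓔p_pos
  rw [𝓔p_sub_up]
  positivity

theorem uq_pos (w : ℝ) : 0 < c.uq w := mul_pos c.𝓔q_pos (Real.exp_pos w)

/-- `s_p'(u_p(w)) = w`. -/
theorem log_up_sub_log (w : ℝ) : Real.log (c.up w) - Real.log (c.𝓔p - c.up w) = w := by
  rw [← Real.log_div (c.up_pos w).ne' (c.𝓔p_sub_up_pos w).ne', 𝓔p_sub_up, up]
  have h1 := c.𝓔p_pos.ne'
  have h2 : 1 + Real.exp w ≠ 0 := by positivity
  have : c.𝓔p * (Real.exp w / (1 + Real.exp w)) / (c.𝓔p / (1 + Real.exp w)) = Real.exp w := by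
    field_simp
  rw [this, Real.log_exp]

theorem sq_uq (w : ℝ) : c.sq (c.uq w) = c.uq w * (w - 1) + c.𝓔q := by
  rw [sq, uq, inv_mul_cancel_left₀ c.𝓔q_pos.ne', Real.log_exp]

/-- The tangent line inequality for the convex function `s_p`, at the point `u_p(w)`. -/
theorem sp_up_sub_le {v : ℝ} (hv : 0 ≤ v) (hv' : v ≤ c.𝓔p) (w : ℝ) :
    c.sp (c.up w) - c.sp v ≤ (c.up w - v) * w := by
  have h1 := sub_le_mul_log_sub_mul_log (c.up_pos w) hv
  have h2 := sub_le_mul_log_sub_mul_log (c.𝓔p_sub_up_pos w) (sub_nonneg.2 hv')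
  have h3 : (c.up w - v) * w
      = (c.up w - v) * (Real.log (c.up w) - Real.log (c.𝓔p - c.up w)) := by
    rw [log_up_sub_log]
  rw [h3]
  unfold sp
  linarith

/-- The tangent line inequality for the convex function `s_q`, at the point `u_q(w)`. -/
theorem sq_uq_sub_le {v : ℝ} (hv : 0 ≤ v) (w : ℝ) :
    c.sq (c.uq w) - c.sq v ≤ (c.uq w - v) * w := by
  have h1 := sub_le_mul_log_sub_mul_log (c.uq_pos w) hv
  rw [sq_uq, sq]
  rcases hv.eq_or_lt with rfl | hv
  · simp; linarith [c.uq_pos w]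
  · rw [uq, Real.log_mul c.𝓔q_pos.ne' (Real.exp_ne_zero _), Real.log_exp] at h1
    rw [Real.log_mul (inv_ne_zero c.𝓔q_pos.ne') hv.ne', Real.log_inv, uq]
    linarith

theorem sq_nonneg {v : ℝ} (hv : 0 ≤ v) : 0 ≤ c.sq v := by
  have h := c.sq_uq_sub_le hv 0
  have h0 : c.sq (c.uq 0) = 0 := by
    rw [sq_uq]
    simp [uq]
  linarith

theorem spDD_up (w : ℝ) : c.spDD (c.up w) = 1 / (c.up w * (c.𝓔p⁻¹ * (c.𝓔p - c.up w))) := by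
  rw [spDD, mul_sub c.𝓔p⁻¹, inv_mul_cancel₀ c.𝓔p_pos.ne']

theorem le_spDD_up (w : ℝ) : 4 * c.𝓔p⁻¹ ≤ c.spDD (c.up w) := by
  have h1 := c.up_pos w
  have h2 := c.𝓔p_sub_up_pos w
  have h3 := c.𝓔p_pos
  rw [spDD_up, le_div_iff₀ (by positivity)]
  field_simp
  nlinarith [_root_.sq_nonneg (c.𝓔p - 2 * c.up w)]

theorem sqDD_uq (w : ℝ) : sqDD (c.uq w) = c.𝓔q⁻¹ * Real.exp (-w) := by
  rw [sqDD, uq, one_div, mul_inv, Real.exp_neg]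

theorem fp_mul_le (w q : ℝ) (hq : 0 ≤ q) :
    c.fp (c.up w) q * w ≤ c.lp * c.𝓔p + c.μpq * c.𝓔p * q := by
  have hE := c.𝓔p_pos
  have hl := c.lp_pos
  have hm := c.μpq_pos
  have he := Real.exp_pos w
  have h1 : c.𝓔p / (1 + Real.exp w) * w ≤ c.𝓔p := by
    rw [div_mul_eq_mul_div, div_le_iff₀ (by positivity)]
    nlinarith [Real.add_one_le_exp w]
  have h2 : -c.𝓔p ≤ c.up w * w := by
    rw [up, mul_div_assoc', div_mul_eq_mul_div, le_div_iff₀ (by positivity)]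
    nlinarith [neg_one_le_mul_exp w, mul_pos hE he]
  have hκ : c.κp = c.lp * c.𝓔p := by rw [𝓔p, mul_div_cancel₀ _ hl.ne']
  have h3 : c.fp (c.up w) q * w
      = c.lp * (c.𝓔p / (1 + Real.exp w) * w) - c.μpq * q * (c.up w * w) := by
    rw [← 𝓔p_sub_up, fp, hκ]
    ring
  rw [h3]
  have := mul_le_mul_of_nonneg_left h1 hl.le
  have := mul_le_mul_of_nonneg_left h2 (mul_nonneg hm.le hq)
  linarith

theorem fq_mul_le {p : ℝ} (hp : 0 ≤ p) (hp' : p ≤ c.𝓔p) (w : ℝ) :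
    c.fq p (c.uq w) * w ≤ c.μpq * c.𝓔p * c.𝓔q * (w * Real.exp w + 2) := by
  have hEq := c.𝓔q_pos
  have hlq := c.lq_le
  have hl := c.lq_pos
  have hm := c.μpq_pos
  have h3 := neg_one_le_mul_exp w
  have h1 : c.fq p (c.uq w) * w = c.𝓔q * ((c.μpq * p - c.lq) * (w * Real.exp w)) := by
    rw [fq, uq]
    ring
  have hmp : c.μpq * p ≤ c.μpq * c.𝓔p := mul_le_mul_of_nonneg_left hp' hm.le
  have hmp0 : 0 ≤ c.μpq * p := mul_nonneg hm.le hp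
  have h2 : (c.μpq * p - c.lq) * (w * Real.exp w) ≤ c.μpq * c.𝓔p * (w * Real.exp w + 2) := by
    rcases le_total 0 (w * Real.exp w) with h | h <;> nlinarith
  rw [h1]
  calc _ ≤ c.𝓔q * (c.μpq * c.𝓔p * (w * Real.exp w + 2)) := mul_le_mul_of_nonneg_left h2 hEq.le
    _ = _ := by ring

theorem le_Cf_mul (w : ℝ) :
    c.lp * c.𝓔p + c.μpq * c.𝓔p * c.uq w + c.μpq * c.𝓔p * c.𝓔q * (w * Real.exp w + 2)
      ≤ c.Cf * (c.𝓔q + c.sq (c.uq w)) := by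
  have hEp := c.𝓔p_pos
  have hEq := c.𝓔q_pos
  have hl := c.lp_pos
  have hm := c.μpq_pos
  have hs := c.sq_nonneg (c.uq_pos w).le
  refine le_trans ?_ (mul_le_mul_of_nonneg_right c.Cf_ge (by positivity))
  have h1 : 2 * c.𝓔p * (c.lp / c.𝓔q + 2 * c.μpq) * (c.𝓔q + c.sq (c.uq w))
      = 2 * c.lp * c.𝓔p + 2 * c.𝓔p * (c.lp / c.𝓔q) * c.sq (c.uq w)
        + 4 * (c.μpq * c.𝓔p * c.𝓔q) * (Real.exp w * (w - 1) + 2) := by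
    rw [sq_uq, uq]
    field_simp
    ring
  have h2 : 0 ≤ 2 * c.𝓔p * (c.lp / c.𝓔q) * c.sq (c.uq w) := by positivity
  have h5 : c.uq w = c.𝓔q * Real.exp w := rfl
  rw [h1]
  have h3 := mul_nonneg (by positivity : 0 ≤ 3 * (c.μpq * c.𝓔p * c.𝓔q))
    (exp_mul_sub_add_two_nonneg w)
  have h4 : 0 < c.lp * c.𝓔p := by positivity
  linear_combination h2 + h3 + h4 + c.μpq * c.𝓔p * h5

/-- The entropy production of the reaction is controlled by the entropy of `q` alone. -/
theorem reaction_le (w w' : ℝ) :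
    c.fp (c.up w) (c.uq w') * w + c.fq (c.up w) (c.uq w') * w'
      ≤ c.Cf * (c.𝓔q + c.sq (c.uq w')) := by
  linarith [c.fp_mul_le w _ (c.uq_pos w').le, c.le_Cf_mul w',
    c.fq_mul_le (c.up_pos w).le (sub_pos.1 (c.𝓔p_sub_up_pos w)).le w']

theorem reaction_q_le (w w' : ℝ) :
    c.fq (c.up w) (c.uq w') * w' ≤ c.Cf * (c.𝓔q + c.sq (c.uq w')) := by
  have h1 := mul_pos c.lp_pos c.𝓔p_pos
  have h2 := mul_pos (mul_pos c.μpq_pos c.𝓔p_pos) (c.uq_pos w')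
  linarith [c.le_Cf_mul w', c.fq_mul_le (c.up_pos w).le (sub_pos.1 (c.𝓔p_sub_up_pos w)).le w']

theorem continuous_up : Continuous c.up := by
  unfold up
  exact continuous_const.mul (Real.continuous_exp.div (by fun_prop) fun w => by positivity)

theorem continuous_uq : Continuous c.uq := by
  unfold uq
  fun_prop

theorem continuous_sp : Continuous c.sp := by
  unfold sp
  have h : Continuous fun p => (c.𝓔p - p) * Real.log (c.𝓔p - p) :=
    Real.continuous_mul_log.comp (continuous_const.sub continuous_id)
  exact (Real.continuous_mul_log.add h).add continuous_const

theorem continuous_sq : Continuous c.sq := by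
  have h : c.sq = fun q => c.𝓔q * ((c.𝓔q⁻¹ * q) * Real.log (c.𝓔q⁻¹ * q)) - q + c.𝓔q := by
    funext q
    have := c.𝓔q_pos.ne'
    rw [sq]
    field_simp
  have h2 : Continuous fun q => (c.𝓔q⁻¹ * q) * Real.log (c.𝓔q⁻¹ * q) :=
    Real.continuous_mul_log.comp (continuous_const.mul continuous_id)
  rw [h]
  fun_prop

theorem continuous_spDD_up : Continuous fun w => c.spDD (c.up w) := by
  simp only [spDD_up]
  have := c.continuous_up
  refine continuous_const.div (by fun_prop) fun w => ?_
  have h1 := c.up_pos w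
  have h2 := c.𝓔p_sub_up_pos w
  have h3 := c.𝓔p_pos
  positivity

theorem continuous_sqDD_uq : Continuous fun w => sqDD (c.uq w) := by
  simp only [sqDD_uq]
  fun_prop

end Coeffs

/-! ### Integrability -/

theorem integrable_comp_of_bounded {X : Type*} [MeasurableSpace X] {μ : Measure X}
    [IsFiniteMeasure μ] {g : ℝ → ℝ} (hg : Continuous g) {f : X → ℝ} (hf : AEMeasurable f μ)
    {a b : ℝ} (hab : ∀ᵐ x ∂μ, f x ∈ Set.Icc a b) : Integrable (fun x => g (f x)) μ := by
  obtain ⟨C, hC⟩ := (isCompact_Icc (a := a) (b := b)).exists_bound_of_continuousOn hg.continuousOn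
  exact Integrable.of_bound (hg.measurable.comp_aemeasurable hf).aestronglyMeasurable C
    (hab.mono fun x hx => hC _ hx)

namespace SimplicialMesh

variable {d : ℕ} {Ω : Set (Pt d)} {𝒯 : SimplicialMesh Ω} {ℓ : ℕ}

theorem measurable_valW (v : 𝒯.W ℓ) : Measurable (valW v) := measurable_glue _

theorem exists_bound_comp_valW (a b : 𝒯.W ℓ) {Φ : ℝ → ℝ → ℝ}
    (hΦ : Continuous fun y : ℝ × ℝ => Φ y.1 y.2) :
    ∃ C, ∀ x, ‖Φ (valW a x) (valW b x)‖ ≤ C := by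
  obtain ⟨A, hA⟩ := exists_bound_glue fun K => (a K : MvPolynomial (Fin d) ℝ)
  obtain ⟨B, hB⟩ := exists_bound_glue fun K => (b K : MvPolynomial (Fin d) ℝ)
  obtain ⟨C, hC⟩ := ((isCompact_closedBall (0 : ℝ) A).prod
    (isCompact_closedBall (0 : ℝ) B)).exists_bound_of_continuousOn hΦ.continuousOn
  exact ⟨C, fun x => hC (valW a x, valW b x)
    ⟨mem_closedBall_zero_iff.2 (hA x), mem_closedBall_zero_iff.2 (hB x)⟩⟩

theorem measurable_comp_valW (a b : 𝒯.W ℓ) {Φ : ℝ → ℝ → ℝ}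
    (hΦ : Continuous fun y : ℝ × ℝ => Φ y.1 y.2) :
    Measurable fun x => Φ (valW a x) (valW b x) :=
  hΦ.measurable.comp ((measurable_valW a).prodMk (measurable_valW b))

theorem integrable_comp_valW₂ (hΩ : Bornology.IsBounded Ω) (a b : 𝒯.W ℓ) {Φ : ℝ → ℝ → ℝ}
    (hΦ : Continuous fun y : ℝ × ℝ => Φ y.1 y.2) :
    Integrable (fun x => Φ (valW a x) (valW b x)) (volume.restrict Ω) := by
  obtain ⟨C, hC⟩ := exists_bound_comp_valW a b hΦ
  have : IsFiniteMeasure (volume.restrict Ω) := ⟨by simpa using hΩ.measure_lt_top⟩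
  exact Integrable.of_bound (measurable_comp_valW a b hΦ).aestronglyMeasurable C (ae_of_all _ hC)

theorem integrable_comp_valW (hΩ : Bornology.IsBounded Ω) (a : 𝒯.W ℓ) {g : ℝ → ℝ}
    (hg : Continuous g) : Integrable (fun x => g (valW a x)) (volume.restrict Ω) :=
  integrable_comp_valW₂ hΩ a a (Φ := fun y _ => g y) (hg.comp continuous_fst)

/-! ### The jump terms -/

theorem normalDiffusion_nonneg {D : Pt d → Matrix (Fin d) (Fin d) ℝ} {dupd : ℝ}
    (hD : IsDiffusionTensor Ω D dupd) (K : 𝒯.Elem) (F : 𝒯.IntFacet) (x : Pt d) :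
    0 ≤ normalDiffusion D K F x := by
  have hK : K.carrier =ᵐ[volume] interior K.carrier :=
    (interior_ae_eq_of_null_frontier
      ((convex_convexHull ℝ (K.1 : Set (Pt d))).addHaar_frontier volume)).symm
  have hpos : ∀ᵐ y ∂(volume.restrict K.carrier), 0 ≤ ⟪normal K F, mulV (D y) (normal K F)⟫ := by
    rw [Measure.restrict_congr_set hK]
    filter_upwards [ae_restrict_of_ae_restrict_of_subset
      (𝒯.interior_subset K.1 K.2.1 K.2.2) hD.coercive] with y hy
    exact le_trans (by have := hD.dupd_pos; positivity) (hy _)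
  have hmean : ∀ r : ℝ, 0 ≤ ⨍ y in Metric.ball x r ∩ K.carrier,
      ⟪normal K F, mulV (D y) (normal K F)⟫ := fun r => by
    rw [setAverage_eq]
    exact smul_nonneg (inv_nonneg.2 measureReal_nonneg) (integral_nonneg_of_ae
      (ae_restrict_of_ae_restrict_of_subset Set.inter_subset_right hpos))
  -- No upper bound of the means is needed: were they unbounded, the infimum would be `0`.
  refine Real.sInf_nonneg fun a ha => ?_
  obtain ⟨r, hr⟩ := Filter.Eventually.exists (f := 𝓝[>] (0 : ℝ)) ha
  exact (hmean r).trans hr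

theorem stabParam_nonneg {D : Pt d → Matrix (Fin d) (Fin d) ℝ} {dupd η₀ : ℝ}
    (hD : IsDiffusionTensor Ω D dupd) (hη : 0 ≤ η₀) (F : 𝒯.IntFacet) (x : Pt d) :
    0 ≤ stabParam D η₀ ℓ F x := by
  have h1 := normalDiffusion_nonneg hD F.K₁ F x
  have h2 := normalDiffusion_nonneg hD F.K₂ F x
  unfold stabParam
  positivity

theorem jumpForm_self {D : Pt d → Matrix (Fin d) (Fin d) ℝ} {dupd η₀ : ℝ}
    (hD : IsDiffusionTensor Ω D dupd) (hη : 0 ≤ η₀) (w : 𝒯.W ℓ) :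
    jumpForm D η₀ w w = jumpNormSq D η₀ w := by
  unfold jumpForm jumpNormSq
  refine Finset.sum_congr rfl fun F _ => congrArg F.integral (funext fun x => ?_)
  have hh : 0 ≤ F.h := le_min Metric.diam_nonneg Metric.diam_nonneg
  rw [real_inner_smul_left, real_inner_self_eq_norm_sq, norm_smul, mul_pow, Real.norm_eq_abs,
    sq_abs, mul_pow, inv_pow, Real.sq_sqrt (stabParam_nonneg hD hη F x), Real.sq_sqrt hh]

theorem jumpNormSq_nonneg (D : Pt d → Matrix (Fin d) (Fin d) ℝ) (η₀ : ℝ) (w : 𝒯.W ℓ) :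
    0 ≤ jumpNormSq D η₀ w :=
  Finset.sum_nonneg fun _ _ => integral_nonneg fun _ => by positivity

/-! ### The diffusion term -/

theorem mulV_smul (A : Matrix (Fin d) (Fin d) ℝ) (a : ℝ) (v : Pt d) :
    mulV A (a • v) = a • mulV A v := by
  ext i
  simp only [mulV, PiLp.smul_apply, Matrix.mulVec, dotProduct, smul_eq_mul, Finset.mul_sum]
  exact Finset.sum_congr rfl fun j _ => by ring

theorem inner_mulV_comm {A : Matrix (Fin d) (Fin d) ℝ} (hA : A.IsSymm) (v w : Pt d) :
    ⟪mulV A v, w⟫ = ⟪mulV A w, v⟫ := by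
  simp only [mulV, PiLp.inner_apply, Matrix.mulVec, dotProduct, RCLike.inner_apply, conj_trivial,
    Finset.mul_sum]
  rw [Finset.sum_comm]
  refine Finset.sum_congr rfl fun i _ => Finset.sum_congr rfl fun j _ => ?_
  rw [← hA.apply i j]
  ring

theorem valR_neg (φ : 𝒯.R ℓ) (x : Pt d) : valR (-φ) x = -valR φ x := by
  rw [← neg_one_smul ℝ φ, valR_smul, neg_one_smul]

theorem integrable_mulV_valR (hΩ : Bornology.IsBounded Ω)
    {D : Pt d → Matrix (Fin d) (Fin d) ℝ} {dupd : ℝ} (hD : IsDiffusionTensor Ω D dupd)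
    (σ : 𝒯.R ℓ) (i : Fin d) :
    Integrable (fun x => mulV (D x) (valR σ x) i) (volume.restrict Ω) := by
  have : IsFiniteMeasure (volume.restrict Ω) := ⟨by simpa using hΩ.measure_lt_top⟩
  exact integrable_finsetSum Finset.univ fun j _ =>
    integrable_mul_glue ((hD.memLp i j).integrable le_top)
      fun K => (σ K j : MvPolynomial (Fin d) ℝ)

/-- The identity `(div_LDG r, w) = (r, z) = (σ, D z) = (D s'' σ, σ)`, combined with the coercivity of
`D` and a lower bound `m` of `s''(u(w))`, here the function `g(w)`. -/
theorem diffusion_ge (hΩ : Bornology.IsBounded Ω)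
    {D : Pt d → Matrix (Fin d) (Fin d) ℝ} {dupd : ℝ} (hD : IsDiffusionTensor Ω D dupd)
    {γ : 𝒯.IntFacet → ℝ} {g : ℝ → ℝ} (hg : Continuous g) {w : 𝒯.W ℓ} {z σ r : 𝒯.R ℓ}
    (hz : z = -gradLDG γ w)
    (hσ : ∀ φ : 𝒯.R ℓ, ∫ x in Ω, ⟪mulV (D x) (g (valW w x) • valR σ x), valR φ x⟫
      = ∫ x in Ω, ⟪mulV (D x) (valR z x), valR φ x⟫)
    (hr : r = projR ℓ (fun x => mulV (D x) (valR σ x)))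
    {m : ℝ} (hm0 : 0 ≤ m) (hm : ∀ᵐ x ∂(volume.restrict Ω), m ≤ g (valW w x)) :
    dupd * m * normSqR σ ≤ ∫ x in Ω, valW (divLDG γ r) x * valW w x := by
  have hDσ := integrable_inner_valR (integrable_mulV_valR hΩ hD σ) σ
  have h1 : ∫ x in Ω, valW (divLDG γ r) x * valW w x
      = ∫ x in Ω, ⟪mulV (D x) (valR σ x), valR z x⟫ := by
    rw [divLDG_spec hΩ, ← integral_neg, ← projR_spec hΩ (integrable_mulV_valR hΩ hD σ), ← hr, hz]
    simp only [valR_neg, inner_neg_right]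
  have h2 : ∫ x in Ω, ⟪mulV (D x) (valR σ x), valR z x⟫
      = ∫ x in Ω, g (valW w x) * ⟪mulV (D x) (valR σ x), valR σ x⟫ := by
    have h := hσ σ
    simp only [mulV_smul, real_inner_smul_left] at h
    rw [h]
    exact integral_congr_ae (hD.symm.mono fun x hx => inner_mulV_comm hx _ _)
  rw [h1, h2, normSqR, ← integral_const_mul]
  have hΦ : Continuous fun y : ℝ × ℝ => g y.1 := hg.comp continuous_fst
  obtain ⟨C, hC⟩ := exists_bound_comp_valW w w (Φ := fun y _ => g y) hΦ
  refine integral_mono_of_nonneg (ae_of_all _ fun x => ?_) (hDσ.bdd_mul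
    (measurable_comp_valW w w (Φ := fun y _ => g y) hΦ).aestronglyMeasurable (ae_of_all _ hC)) ?_
  · have := hD.dupd_pos
    change 0 ≤ dupd * m * ‖valR σ x‖ ^ 2
    positivity
  · filter_upwards [hm, hD.coercive] with x h3 h4
    have h5 := h4 (valR σ x)
    rw [real_inner_comm] at h5
    have h6 : 0 ≤ dupd * ‖valR σ x‖ ^ 2 := by
      have := hD.dupd_pos
      positivity
    calc dupd * m * ‖valR σ x‖ ^ 2 = m * (dupd * ‖valR σ x‖ ^ 2) := by ring
      _ ≤ _ := mul_le_mul h3 h5 h6 (hm0.trans h3)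

end SimplicialMesh

/-! ### The entropy inequality of one step -/

section Scheme

open SimplicialMesh

variable {d : ℕ} {Ω : Set (Pt d)} {𝒯 : SimplicialMesh Ω} {ℓ : ℕ}

/-- The function `u(w^n)`, understood as the initial datum `u₀` if `n = 0`. -/
noncomputable def concentration (u : ℝ → ℝ) (u₀ : Pt d → ℝ) (w : ℕ → 𝒯.W ℓ) (n : ℕ)
    (x : Pt d) : ℝ :=
  if n = 0 then u₀ x else u (valW (w n) x)

theorem transmitted_eq (u : ℝ → ℝ) (u₀ : Pt d → ℝ) (w : ℕ → 𝒯.W ℓ) (n : ℕ) :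
    transmitted u u₀ w n = projW ℓ (concentration u u₀ w n) := by
  unfold transmitted concentration
  split_ifs <;> rfl

theorem entropyAt_eq (s u : ℝ → ℝ) (u₀ : Pt d → ℝ) (w : ℕ → 𝒯.W ℓ) (n : ℕ) :
    entropyAt s u u₀ w n = ∫ x in Ω, s (concentration u u₀ w n x) := by
  unfold entropyAt concentration
  split_ifs <;> rfl

theorem entropyAt_succ (s u : ℝ → ℝ) (u₀ : Pt d → ℝ) (w : ℕ → 𝒯.W ℓ) (n : ℕ) :
    entropyAt s u u₀ w (n + 1) = ∫ x in Ω, s (u (valW (w (n + 1)) x)) := if_neg n.succ_ne_zero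

theorem aemeasurable_concentration {u : ℝ → ℝ} (hu : Continuous u) {u₀ : Pt d → ℝ}
    (hu₀ : AEMeasurable u₀ (volume.restrict Ω)) (w : ℕ → 𝒯.W ℓ) (n : ℕ) :
    AEMeasurable (concentration u u₀ w n) (volume.restrict Ω) := by
  unfold concentration
  split_ifs
  · exact hu₀
  · exact (hu.measurable.comp (measurable_valW _)).aemeasurable

/-- The scheme tested with `w`: the convexity of the entropy density `s` (in the form of its tangent
line inequality `htan` at `u(w)`, where `s'(u(w)) = w`) bounds the discrete time derivative. -/
theorem IsStep.entropy_le (hΩ : Bornology.IsBounded Ω)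
    {D : Pt d → Matrix (Fin d) (Fin d) ℝ} {dupd : ℝ} (hD : IsDiffusionTensor Ω D dupd)
    {γ : 𝒯.IntFacet → ℝ} {η₀ : ℝ} (hη : 0 ≤ η₀) {B : LDGProduct (𝒯.W ℓ)} {ε τ : ℝ} (hτ : 0 < τ)
    {u sDD s : ℝ → ℝ} (hu : Continuous u) (hsDD : Continuous fun y => sDD (u y))
    (hs : Continuous s) {v f : Pt d → ℝ} {w : 𝒯.W ℓ} {z σ r : 𝒯.R ℓ}
    (h : IsStep D γ η₀ B ε τ u sDD (projW ℓ v) f w z σ r)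
    (hv : Integrable v (volume.restrict Ω))
    (hsv : Integrable (fun x => s (v x)) (volume.restrict Ω))
    (htan : ∀ᵐ x ∂(volume.restrict Ω),
      s (u (valW w x)) - s (v x) ≤ (u (valW w x) - v x) * valW w x)
    {m : ℝ} (hm0 : 0 ≤ m) (hm : ∀ᵐ x ∂(volume.restrict Ω), m ≤ sDD (u (valW w x))) :
    ε * τ * B.form w w + (∫ x in Ω, s (u (valW w x))) + dupd * m * τ * normSqR σ
        + τ * jumpNormSq D η₀ w
      ≤ (∫ x in Ω, s (v x)) + τ * ∫ x in Ω, f x * valW w x := by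
  have hui := integrable_comp_valW hΩ w hu
  have hsu : Integrable (fun x => s (u (valW w x))) (volume.restrict Ω) :=
    integrable_comp_valW hΩ w (hs.comp hu)
  have hmul : ∀ {g : Pt d → ℝ}, Integrable g (volume.restrict Ω) →
      Integrable (fun x => g x * valW w x) (volume.restrict Ω) :=
    fun hg => integrable_mul_glue hg _
  have h1 := diffusion_ge hΩ hD hsDD h.z_eq h.σ_eq h.r_eq hm0 hm
  have h2 : (∫ x in Ω, s (u (valW w x))) - ∫ x in Ω, s (v x)
      ≤ ∫ x in Ω, (u (valW w x) - valW (projW (𝒯 := 𝒯) ℓ v) x) * valW w x := by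
    have h3 : ∫ x in Ω, (u (valW w x) - valW (projW (𝒯 := 𝒯) ℓ v) x) * valW w x
        = ∫ x in Ω, (u (valW w x) - v x) * valW w x := by
      simp only [sub_mul]
      rw [integral_sub (hmul hui) (hmul (g := valW (projW ℓ v)) (integrable_glue hΩ _)),
        integral_sub (hmul hui) (hmul hv), projW_spec hΩ hv]
    rw [h3, ← integral_sub hsu hsv]
    exact integral_mono_ae (hsu.sub hsv) (hmul (hui.sub hv)) htan
  have h4 := h.w_eq w
  rw [jumpForm_self hD hη] at h4
  rw [← h4]
  have h5 : τ * (1 / τ * ∫ x in Ω, (u (valW w x) - valW (projW (𝒯 := 𝒯) ℓ v) x) * valW w x)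
      = ∫ x in Ω, (u (valW w x) - valW (projW (𝒯 := 𝒯) ℓ v) x) * valW w x := by
    rw [one_div, mul_inv_cancel_left₀ hτ.ne']
  have h6 := mul_le_mul_of_nonneg_left h1 hτ.le
  linear_combination h2 + h6 - h5

end Scheme

/-! ### Time meshes and the discrete Gronwall inequality -/

namespace TimeMesh

variable {T : ℝ} (𝒥 : TimeMesh T)

theorem step_pos {n : ℕ} (hn : n < 𝒥.N) : 0 < 𝒥.step n := sub_pos.2 (𝒥.t_lt n hn)

theorem step_le_size {n : ℕ} (hn : n < 𝒥.N) : 𝒥.step n ≤ 𝒥.size :=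
  le_ciSup (f := fun n : Fin 𝒥.N => 𝒥.step n) (Set.finite_range _).bddAbove ⟨n, hn⟩

theorem sum_step : ∑ n ∈ Finset.range 𝒥.N, 𝒥.step n = T := by
  unfold step
  rw [Finset.sum_range_sub, 𝒥.t_last, 𝒥.t_zero, sub_zero]

theorem t_le {n : ℕ} (hn : n ≤ 𝒥.N) : 𝒥.t n ≤ T := by
  refine le_of_le_of_eq ?_ 𝒥.t_last
  exact Nat.decreasingInduction (motive := fun m _ => 𝒥.t m ≤ 𝒥.t 𝒥.N)
    (fun k hk h => (𝒥.t_lt k hk).le.trans h) le_rfl hn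

theorem t_nonneg {n : ℕ} (hn : n ≤ 𝒥.N) : 0 ≤ 𝒥.t n := by
  induction n with
  | zero => exact 𝒥.t_zero.ge
  | succ k ih => exact (ih (by omega)).trans (𝒥.t_lt k (by omega)).le

theorem one_le_of_isQuasiUniform (hT : 0 < T) {Cqu : ℝ} (h : 𝒥.IsQuasiUniform Cqu) : 1 ≤ Cqu := by
  have hN : 0 < 𝒥.N := by
    rcases Nat.eq_zero_or_pos 𝒥.N with h0 | h0
    · have := 𝒥.t_last
      rw [h0, 𝒥.t_zero] at this
      exact absurd this hT.ne
    · exact h0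
  have h1 := (𝒥.step_le_size hN).trans (h 0 hN)
  exact le_of_mul_le_mul_right (by linarith) (𝒥.step_pos hN)

end TimeMesh

/-- The growth factor `1 / (1 - x)` of an implicit Euler step is at most `e^{3x/2}` for `x ≤ 1/2`. -/
theorem one_le_exp_mul_one_sub {x : ℝ} (h0 : 0 ≤ x) (h1 : x ≤ 1 / 2) :
    1 ≤ Real.exp (3 / 2 * x) * (1 - x) := by
  have h2 := Real.quadratic_le_exp_of_nonneg (by linarith : 0 ≤ 3 / 2 * x)
  have h3 : 0 ≤ 1 - x := by linarith
  nlinarith [mul_le_mul_of_nonneg_right h2 h3, mul_nonneg h0 (sub_nonneg.2 h1),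
    mul_nonneg (mul_nonneg h0 h0) (sub_nonneg.2 h1)]

namespace TimeMesh

variable {T : ℝ} (𝒥 : TimeMesh T)

/-- The discrete Gronwall inequality with an implicit right-hand side: `E + a` grows by a factor of
at most `1 / (1 - k τ_{n+1})` in each step. -/
theorem gronwall {E : ℕ → ℝ} {k a : ℝ} (hk : 0 < k) (hsmall : 𝒥.size < 1 / (2 * k))
    (ha : 0 ≤ a) (hE0 : ∀ n, 0 ≤ E n)
    (hE : ∀ n < 𝒥.N, E (n + 1) ≤ E n + k * 𝒥.step n * (a + E (n + 1))) {n : ℕ} (hn : n ≤ 𝒥.N) :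
    E n + a ≤ Real.exp (3 / 2 * k * 𝒥.t n) * (E 0 + a) := by
  induction n with
  | zero => simp [𝒥.t_zero]
  | succ n ih =>
    have hx0 : 0 ≤ k * 𝒥.step n := mul_nonneg hk.le (𝒥.step_pos hn).le
    have hx1 : k * 𝒥.step n ≤ 1 / 2 := by
      have h := (𝒥.step_le_size hn).trans hsmall.le
      rw [le_div_iff₀ (by positivity)] at h
      linarith
    have h1 := mul_le_mul_of_nonneg_right (one_le_exp_mul_one_sub hx0 hx1)
      (add_nonneg (hE0 (n + 1)) ha)
    have h2 : (1 - k * 𝒥.step n) * (E (n + 1) + a) ≤ E n + a := by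
      linear_combination hE n hn
    have h3 : 𝒥.t (n + 1) = 𝒥.t n + 𝒥.step n := by unfold step; ring
    calc E (n + 1) + a
        ≤ Real.exp (3 / 2 * (k * 𝒥.step n)) * ((1 - k * 𝒥.step n) * (E (n + 1) + a)) := by
          linarith
      _ ≤ Real.exp (3 / 2 * (k * 𝒥.step n)) * (Real.exp (3 / 2 * k * 𝒥.t n) * (E 0 + a)) := by
          exact mul_le_mul_of_nonneg_left (h2.trans (ih (by omega))) (Real.exp_pos _).le
      _ = _ := by
          rw [← mul_assoc, ← Real.exp_add, h3]
          ring_nf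

/-- The form of the discrete Gronwall inequality that produces the constant `C*`; quasi-uniformity
enters only through `1 ≤ Cqu`. -/
theorem gronwall' {E : ℕ → ℝ} {k a Cqu : ℝ} (hk : 0 < k) (hsmall : 𝒥.size < 1 / (2 * k))
    (ha : 0 ≤ a) (hE0 : ∀ n, 0 ≤ E n)
    (hE : ∀ n < 𝒥.N, E (n + 1) ≤ E n + k * 𝒥.step n * (a + E (n + 1)))
    (hT : 0 < T) (hC : 1 ≤ Cqu) {n : ℕ} (hn : n ≤ 𝒥.N) :
    E n ≤ Real.exp (3 / 2 * k * Cqu * T) * (E 0 + 2 * a * k * T) := by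
  have h1 := 𝒥.gronwall hk hsmall ha hE0 hE hn
  set g := 3 / 2 * k * 𝒥.t n with hg
  have h2 : g ≤ 3 / 2 * k * T := mul_le_mul_of_nonneg_left (𝒥.t_le hn) (by positivity)
  have hkT : 0 < k * T := mul_pos hk hT
  have h3 : g ≤ 3 / 2 * k * Cqu * T := by nlinarith
  have h4 := Real.exp_pos g
  -- `e^g - 1 ≤ g e^g`
  have h5 : Real.exp g - 1 ≤ g * Real.exp g := by
    have h := mul_le_mul_of_nonneg_right (Real.add_one_le_exp (-g)) h4.le
    rw [← Real.exp_add, neg_add_cancel, Real.exp_zero] at h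
    linarith
  have h6 : g * Real.exp g ≤ 2 * (k * T) * Real.exp g :=
    mul_le_mul_of_nonneg_right (by linarith) h4.le
  have h7 := mul_le_mul_of_nonneg_left (h5.trans h6) ha
  have h8 : 0 ≤ E 0 + 2 * a * k * T := add_nonneg (hE0 0) (by positivity)
  have h9 := mul_le_mul_of_nonneg_right (Real.exp_le_exp.2 h3) h8
  linarith

end TimeMesh

/-! ### Entropy inequalities for the solutions of the scheme -/

section Scheme

open SimplicialMesh

variable {d : ℕ} {Ω : Set (Pt d)} {𝒯 : SimplicialMesh Ω} {ℓ : ℕ}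
variable {T : ℝ} {c : Coeffs} {D : Pt d → Matrix (Fin d) (Fin d) ℝ} {dupd : ℝ}
variable {p₀ q₀ : Pt d → ℝ} {γ : 𝒯.IntFacet → ℝ} {η₀ : ℝ} {B : LDGProduct (𝒯.W ℓ)} {ε : ℝ}
variable {𝒥 : TimeMesh T} {wp wq : ℕ → 𝒯.W ℓ} {σp σq : ℕ → 𝒯.R ℓ}

theorem concentration_p_mem (hp₀ : ∀ᵐ x ∂(volume.restrict Ω), 0 ≤ p₀ x ∧ p₀ x ≤ c.𝓔p) (n : ℕ) :
    ∀ᵐ x ∂(volume.restrict Ω), concentration c.up p₀ wp n x ∈ Set.Icc 0 c.𝓔p := by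
  unfold concentration
  split_ifs
  · exact hp₀
  · exact ae_of_all _ fun x => ⟨(c.up_pos _).le, (sub_pos.1 (c.𝓔p_sub_up_pos _)).le⟩

theorem concentration_q_nonneg (hq₀ : ∀ᵐ x ∂(volume.restrict Ω), 0 ≤ q₀ x) (n : ℕ) :
    ∀ᵐ x ∂(volume.restrict Ω), 0 ≤ concentration c.uq q₀ wq n x := by
  unfold concentration
  split_ifs
  · exact hq₀
  · exact ae_of_all _ fun x => (c.uq_pos _).le

theorem exists_concentration_q_mem (hq₀m : MemLp q₀ ⊤ (volume.restrict Ω))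
    (hq₀ : ∀ᵐ x ∂(volume.restrict Ω), 0 ≤ q₀ x) (n : ℕ) :
    ∃ b, ∀ᵐ x ∂(volume.restrict Ω), concentration c.uq q₀ wq n x ∈ Set.Icc 0 b := by
  have h0 := concentration_q_nonneg (c := c) (wq := wq) hq₀ n
  have hb : ∃ b, ∀ᵐ x ∂(volume.restrict Ω), concentration c.uq q₀ wq n x ≤ b := by
    unfold concentration
    split_ifs
    · refine ⟨_, (ae_le_lpNorm_exponent_top hq₀m).mono fun x hx => (le_abs_self _).trans hx⟩
    · obtain ⟨b, hb⟩ := exists_bound_comp_valW (wq n) (wq n) (Φ := fun y _ => c.uq y)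
        (c.continuous_uq.comp continuous_fst)
      exact ⟨b, ae_of_all _ fun x => (le_abs_self _).trans (hb x)⟩
  obtain ⟨b, hb⟩ := hb
  exact ⟨b, h0.and hb⟩

theorem entropyAt_q_nonneg (hq₀ : ∀ᵐ x ∂(volume.restrict Ω), 0 ≤ q₀ x) (n : ℕ) :
    0 ≤ entropyAt c.sq c.uq q₀ wq n := by
  rw [entropyAt_eq]
  exact integral_nonneg_of_ae ((concentration_q_nonneg hq₀ n).mono fun x hx => c.sq_nonneg hx)

theorem IsSolution.entropy_p_le (h : IsSolution c D p₀ q₀ γ η₀ B ε 𝒥 wp wq σp σq)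
    (hΩ : Bornology.IsBounded Ω) (hD : IsDiffusionTensor Ω D dupd) (hη : 0 ≤ η₀)
    (hp₀m : AEMeasurable p₀ (volume.restrict Ω))
    (hp₀ : ∀ᵐ x ∂(volume.restrict Ω), 0 ≤ p₀ x ∧ p₀ x ≤ c.𝓔p) {n : ℕ} (hn : n < 𝒥.N) :
    ε * 𝒥.step n * B.form (wp (n + 1)) (wp (n + 1)) + entropyAt c.sp c.up p₀ wp (n + 1)
        + dupd * (4 * c.𝓔p⁻¹) * 𝒥.step n * normSqR (σp (n + 1))
        + 𝒥.step n * jumpNormSq D η₀ (wp (n + 1))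
      ≤ entropyAt c.sp c.up p₀ wp n + 𝒥.step n * ∫ x in Ω,
          c.fp (c.up (valW (wp (n + 1)) x)) (c.uq (valW (wq (n + 1)) x)) * valW (wp (n + 1)) x := by
  obtain ⟨z, r, hs⟩ := (h n hn).1
  have : IsFiniteMeasure (volume.restrict Ω) := ⟨by simpa using hΩ.measure_lt_top⟩
  have hm := concentration_p_mem (c := c) (wp := wp) hp₀ n
  have hmeas := aemeasurable_concentration c.continuous_up hp₀m wp n
  rw [transmitted_eq] at hs
  rw [entropyAt_succ, entropyAt_eq]
  have hE := c.𝓔p_pos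
  exact hs.entropy_le hΩ hD hη (𝒥.step_pos hn) c.continuous_up c.continuous_spDD_up c.continuous_sp
    (integrable_comp_of_bounded continuous_id hmeas hm)
    (integrable_comp_of_bounded c.continuous_sp hmeas hm)
    (hm.mono fun x hx => c.sp_up_sub_le hx.1 hx.2 _) (by positivity)
    (ae_of_all _ fun x => c.le_spDD_up _)

theorem IsSolution.entropy_q_le (h : IsSolution c D p₀ q₀ γ η₀ B ε 𝒥 wp wq σp σq)
    (hΩ : Bornology.IsBounded Ω) (hD : IsDiffusionTensor Ω D dupd) (hη : 0 ≤ η₀)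
    (hq₀m : MemLp q₀ ⊤ (volume.restrict Ω)) (hq₀ : ∀ᵐ x ∂(volume.restrict Ω), 0 ≤ q₀ x)
    {n : ℕ} (hn : n < 𝒥.N) {A : ℝ} (hA : ∀ᵐ x ∂(volume.restrict Ω), valW (wq (n + 1)) x ≤ A) :
    ε * 𝒥.step n * B.form (wq (n + 1)) (wq (n + 1)) + entropyAt c.sq c.uq q₀ wq (n + 1)
        + dupd * (c.𝓔q⁻¹ * Real.exp (-A)) * 𝒥.step n * normSqR (σq (n + 1))
        + 𝒥.step n * jumpNormSq D η₀ (wq (n + 1))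
      ≤ entropyAt c.sq c.uq q₀ wq n + 𝒥.step n * ∫ x in Ω,
          c.fq (c.up (valW (wp (n + 1)) x)) (c.uq (valW (wq (n + 1)) x)) * valW (wq (n + 1)) x := by
  obtain ⟨z, r, hs⟩ := (h n hn).2
  have : IsFiniteMeasure (volume.restrict Ω) := ⟨by simpa using hΩ.measure_lt_top⟩
  obtain ⟨b, hm⟩ := exists_concentration_q_mem (c := c) (wq := wq) hq₀m hq₀ n
  have hmeas := aemeasurable_concentration c.continuous_uq hq₀m.1.aemeasurable wq n
  rw [transmitted_eq] at hs
  rw [entropyAt_succ, entropyAt_eq]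
  have hE := c.𝓔q_pos
  exact hs.entropy_le hΩ hD hη (𝒥.step_pos hn) c.continuous_uq c.continuous_sqDD_uq c.continuous_sq
    (integrable_comp_of_bounded continuous_id hmeas hm)
    (integrable_comp_of_bounded c.continuous_sq hmeas hm)
    (hm.mono fun x hx => c.sq_uq_sub_le hx.1 _) (by positivity)
    (hA.mono fun x hx => by
      rw [c.sqDD_uq]
      gcongr)

theorem continuous_reaction (c : Coeffs) :
    (Continuous fun y : ℝ × ℝ => c.fp (c.up y.1) (c.uq y.2) * y.1) ∧
      Continuous fun y : ℝ × ℝ => c.fq (c.up y.1) (c.uq y.2) * y.2 := by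
  have h1 := c.continuous_up
  have h2 := c.continuous_uq
  unfold Coeffs.fp Coeffs.fq
  constructor <;> fun_prop

theorem integral_Cf_mul (hΩ : Bornology.IsBounded Ω) (b : 𝒯.W ℓ) :
    ∫ x in Ω, c.Cf * (c.𝓔q + c.sq (c.uq (valW b x)))
      = c.Cf * (c.𝓔q * volume.real Ω + ∫ x in Ω, c.sq (c.uq (valW b x))) := by
  have : IsFiniteMeasure (volume.restrict Ω) := ⟨by simpa using hΩ.measure_lt_top⟩
  rw [integral_const_mul, integral_add (integrable_const _)
    (integrable_comp_valW hΩ b (g := fun w => c.sq (c.uq w))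
      (c.continuous_sq.comp c.continuous_uq))]
  simp [mul_comm]

theorem integrable_Cf_mul (hΩ : Bornology.IsBounded Ω) (b : 𝒯.W ℓ) :
    Integrable (fun x => c.Cf * (c.𝓔q + c.sq (c.uq (valW b x)))) (volume.restrict Ω) :=
  integrable_comp_valW hΩ b (g := fun w => c.Cf * (c.𝓔q + c.sq (c.uq w)))
    (continuous_const.mul (continuous_const.add (c.continuous_sq.comp c.continuous_uq)))

theorem integral_reaction_le (hΩ : Bornology.IsBounded Ω) (a b : 𝒯.W ℓ) :
    (∫ x in Ω, c.fp (c.up (valW a x)) (c.uq (valW b x)) * valW a x)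
        + ∫ x in Ω, c.fq (c.up (valW a x)) (c.uq (valW b x)) * valW b x
      ≤ c.Cf * (c.𝓔q * volume.real Ω + ∫ x in Ω, c.sq (c.uq (valW b x))) := by
  have h1 := integrable_comp_valW₂ hΩ a b (Φ := fun y z => c.fp (c.up y) (c.uq z) * y)
    (continuous_reaction c).1
  have h2 := integrable_comp_valW₂ hΩ a b (Φ := fun y z => c.fq (c.up y) (c.uq z) * z)
    (continuous_reaction c).2
  rw [← integral_add h1 h2, ← integral_Cf_mul hΩ]
  exact integral_mono (h1.add h2) (integrable_Cf_mul hΩ b) fun x => c.reaction_le _ _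

theorem integral_reaction_q_le (hΩ : Bornology.IsBounded Ω) (a b : 𝒯.W ℓ) :
    ∫ x in Ω, c.fq (c.up (valW a x)) (c.uq (valW b x)) * valW b x
      ≤ c.Cf * (c.𝓔q * volume.real Ω + ∫ x in Ω, c.sq (c.uq (valW b x))) := by
  rw [← integral_Cf_mul hΩ]
  exact integral_mono (integrable_comp_valW₂ hΩ a b
      (Φ := fun y z => c.fq (c.up y) (c.uq z) * z) (continuous_reaction c).2)
    (integrable_Cf_mul hΩ b) fun x => c.reaction_q_le _ _

/-- An upper bound, uniform in the discretization, for the entropy of `q` plus the contribution of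
the reaction during one time step. -/
noncomputable def entropyBound (Ω : Set (Pt d)) (c : Coeffs) (q₀ : Pt d → ℝ) (Cqu T : ℝ) : ℝ :=
  Cstar Ω c q₀ Cqu T + c.Cf * T * (c.𝓔q * volume.real Ω + Cstar Ω c q₀ Cqu T)

/-- The entropy inequality of the second species alone: its reaction term is controlled by its own
entropy, so that it does not involve `p`. -/
theorem IsSolution.step_q_le (h : IsSolution c D p₀ q₀ γ η₀ B ε 𝒥 wp wq σp σq)
    (hΩ : Bornology.IsBounded Ω) (hD : IsDiffusionTensor Ω D dupd) (hη : 0 ≤ η₀)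
    (hq₀m : MemLp q₀ ⊤ (volume.restrict Ω)) (hq₀ : ∀ᵐ x ∂(volume.restrict Ω), 0 ≤ q₀ x)
    {n : ℕ} (hn : n < 𝒥.N) :
    ε * 𝒥.step n * B.form (wq (n + 1)) (wq (n + 1)) + entropyAt c.sq c.uq q₀ wq (n + 1)
      ≤ entropyAt c.sq c.uq q₀ wq n
        + c.Cf * 𝒥.step n * (c.𝓔q * volume.real Ω + entropyAt c.sq c.uq q₀ wq (n + 1)) := by
  obtain ⟨A, hA⟩ := exists_bound_glue fun K => (wq (n + 1) K : MvPolynomial (Fin d) ℝ)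
  have h1 := h.entropy_q_le hΩ hD hη hq₀m hq₀ hn
    (ae_of_all _ fun x => (le_abs_self _).trans (hA x))
  have h2 := mul_le_mul_of_nonneg_left
    (integral_reaction_q_le (c := c) hΩ (wp (n + 1)) (wq (n + 1))) (𝒥.step_pos hn).le
  rw [← entropyAt_succ c.sq c.uq q₀] at h2
  have hE := c.𝓔q_pos
  have h3 := hD.dupd_pos
  have h4 := (𝒥.step_pos hn).le
  have h5 : 0 ≤ normSqR (σq (n + 1)) := integral_nonneg fun x => by positivity
  have h6 := jumpNormSq_nonneg D η₀ (wq (n + 1))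
  have h7 : 0 ≤ dupd * (c.𝓔q⁻¹ * Real.exp (-A)) * 𝒥.step n * normSqR (σq (n + 1)) := by positivity
  have h8 : 0 ≤ 𝒥.step n * jumpNormSq D η₀ (wq (n + 1)) := by positivity
  linarith

theorem IsSolution.entropyAt_q_le_Cstar (h : IsSolution c D p₀ q₀ γ η₀ B ε 𝒥 wp wq σp σq)
    (hΩ : Bornology.IsBounded Ω) (hD : IsDiffusionTensor Ω D dupd) (hη : 0 ≤ η₀)
    (hq₀m : MemLp q₀ ⊤ (volume.restrict Ω)) (hq₀ : ∀ᵐ x ∂(volume.restrict Ω), 0 ≤ q₀ x)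
    (hε : 0 ≤ ε) (hB : ∀ v, 0 ≤ B.form v v) (hT : 0 < T) {Cqu : ℝ} (hC : 1 ≤ Cqu)
    (hsmall : 𝒥.size < 1 / (2 * c.Cf)) {n : ℕ} (hn : n ≤ 𝒥.N) :
    entropyAt c.sq c.uq q₀ wq n ≤ Cstar Ω c q₀ Cqu T := by
  have hE := c.𝓔q_pos
  have h1 := 𝒥.gronwall' (E := entropyAt c.sq c.uq q₀ wq) (a := c.𝓔q * volume.real Ω) c.Cf_pos
    hsmall (by positivity) (entropyAt_q_nonneg hq₀)
    (fun k hk => by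
      have h2 := h.step_q_le hΩ hD hη hq₀m hq₀ hk
      have h3 := mul_nonneg (mul_nonneg hε (𝒥.step_pos hk).le) (hB (wq (k + 1)))
      linarith) hT hC hn
  refine h1.trans_eq ?_
  rw [Cstar, entropyAt, if_pos rfl]
  ring

/-- The `ε`-regularization controls `w_q` in `L^∞`, hence `s_q''(u_q(w_q))` from below. -/
theorem IsSolution.dgNorm_q_le (h : IsSolution c D p₀ q₀ γ η₀ B ε 𝒥 wp wq σp σq)
    (hΩ : Bornology.IsBounded Ω) (hD : IsDiffusionTensor Ω D dupd) (hη : 0 ≤ η₀)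
    (hq₀m : MemLp q₀ ⊤ (volume.restrict Ω)) (hq₀ : ∀ᵐ x ∂(volume.restrict Ω), 0 ≤ q₀ x)
    (hε : 0 < ε) {Ccoer : ℝ} (hCcoer : 0 < Ccoer)
    (hB : ∀ v, Ccoer * B.dgNorm v ^ 2 ≤ B.form v v) (hT : 0 < T) {Cqu : ℝ} (hC : 1 ≤ Cqu)
    (hsmall : 𝒥.size < 1 / (2 * c.Cf)) {n : ℕ} (hn : n < 𝒥.N) :
    B.dgNorm (wq (n + 1))
      ≤ Real.sqrt (entropyBound Ω c q₀ Cqu T / Ccoer) / Real.sqrt (ε * 𝒥.step n) := by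
  have hτ := 𝒥.step_pos hn
  have hB0 : ∀ v, 0 ≤ B.form v v := fun v => le_trans (by positivity) (hB v)
  have h1 := h.step_q_le hΩ hD hη hq₀m hq₀ hn
  have h2 := h.entropyAt_q_le_Cstar hΩ hD hη hq₀m hq₀ hε.le hB0 hT hC hsmall hn.le
  have h3 := h.entropyAt_q_le_Cstar hΩ hD hη hq₀m hq₀ hε.le hB0 hT hC hsmall hn
  have h4 := entropyAt_q_nonneg (c := c) (wq := wq) hq₀ (n + 1)
  have hE := c.𝓔q_pos
  have hCf := c.Cf_pos
  have hτT : 𝒥.step n ≤ T := by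
    rw [TimeMesh.step]
    linarith [𝒥.t_le hn, 𝒥.t_nonneg hn.le]
  have h5 : c.Cf * 𝒥.step n * (c.𝓔q * volume.real Ω + entropyAt c.sq c.uq q₀ wq (n + 1))
      ≤ c.Cf * T * (c.𝓔q * volume.real Ω + Cstar Ω c q₀ Cqu T) := by gcongr
  have h6 := mul_le_mul_of_nonneg_left (hB (wq (n + 1))) (mul_pos hε hτ).le
  rw [← Real.sqrt_div' _ (mul_pos hε hτ).le]
  refine Real.le_sqrt_of_sq_le ?_
  rw [div_div, le_div_iff₀ (by positivity), entropyBound]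
  linarith

theorem ae_valW_le {b : ℝ} (hb : 0 ≤ b) {v : 𝒯.W ℓ}
    (h : eLpNorm (valW v) ⊤ (volume.restrict Ω) ≤ ENNReal.ofReal b) :
    ∀ᵐ x ∂(volume.restrict Ω), valW v x ≤ b := by
  rw [eLpNorm_exponent_top] at h
  filter_upwards [ae_le_eLpNormEssSup (f := valW v) (μ := volume.restrict Ω)] with x hx
  have h1 := hx.trans h
  rw [← ofReal_norm] at h1
  exact (le_abs_self _).trans ((ENNReal.ofReal_le_ofReal_iff hb).1 h1)

end Scheme

end LDG

open LDG LDG.SimplicialMesh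

theorem mainTheorem3 {d : ℕ} (hd : d = 2 ∨ d = 3)
    (Ω : Set (Pt d)) (hΩo : IsOpen Ω) (hΩc : IsConnected Ω) (hΩb : Bornology.IsBounded Ω)
    (c : Coeffs) (D : Pt d → Matrix (Fin d) (Fin d) ℝ) (dupd : ℝ)
    (hD : IsDiffusionTensor Ω D dupd)
    (p₀ q₀ : Pt d → ℝ) (hp₀m : AEMeasurable p₀ (volume.restrict Ω))
    (hp₀ : ∀ᵐ x ∂(volume.restrict Ω), 0 ≤ p₀ x ∧ p₀ x ≤ c.𝓔p)
    (hq₀m : MemLp q₀ ⊤ (volume.restrict Ω)) (hq₀ : ∀ᵐ x ∂(volume.restrict Ω), 0 ≤ q₀ x)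
    (T : ℝ) (hT : 0 < T) (ℓ : ℕ) (hℓ : 1 ≤ ℓ) (η₀ : ℝ) (hη₀ : 0 < η₀)
    (CSob Ccoer Cqu : ℝ) (hCSob : 0 < CSob) (hCcoer : 0 < Ccoer) (hCqu : 0 < Cqu) :
    ∃ C : ℝ, 0 < C ∧
      ∀ (𝒯 : SimplicialMesh Ω) (γ : 𝒯.IntFacet → ℝ) (_ : ∀ F, γ F ∈ Set.Icc (0 : ℝ) 1)
        (B : LDGProduct (𝒯.W ℓ))
        (_ : ∀ v : 𝒯.W ℓ, Ccoer * B.dgNorm v ^ 2 ≤ B.form v v)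
        (_ : ∀ v : 𝒯.W ℓ, eLpNorm (valW v) ⊤ (volume.restrict Ω)
          ≤ ENNReal.ofReal (CSob * B.dgNorm v))
        (ε : ℝ) (_ : 0 < ε)
        (𝒥 : TimeMesh T) (_ : 𝒥.IsQuasiUniform Cqu) (_ : 𝒥.size < 1 / (2 * c.Cf))
        (wp wq : ℕ → 𝒯.W ℓ) (σp σq : ℕ → 𝒯.R ℓ)
        (_ : IsSolution c D p₀ q₀ γ η₀ B ε 𝒥 wp wq σp σq),
        (∀ n < 𝒥.N,
          Ccoer * ε * 𝒥.step n * (B.dgNorm (wp (n + 1)) ^ 2 + B.dgNorm (wq (n + 1)) ^ 2)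
            + ((∫ x in Ω, c.sp (c.up (valW (wp (n + 1)) x)))
              + ∫ x in Ω, c.sq (c.uq (valW (wq (n + 1)) x)))
            + 4 * c.𝓔p⁻¹ * dupd * 𝒥.step n * normSqR (σp (n + 1))
            + c.𝓔q⁻¹ * dupd * 𝒥.step n * Real.exp (-C / Real.sqrt (ε * 𝒥.step n))
              * normSqR (σq (n + 1))
            + 𝒥.step n * (jumpNormSq D η₀ (wp (n + 1)) + jumpNormSq D η₀ (wq (n + 1)))
          ≤ (entropyAt c.sp c.up p₀ wp n + entropyAt c.sq c.uq q₀ wq n)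
            + c.Cf * 𝒥.step n * (c.𝓔q * volume.real Ω + Cstar Ω c q₀ Cqu T)) ∧
        (∑ n ∈ Finset.range 𝒥.N, 𝒥.step n *
            (Ccoer * ε * (B.dgNorm (wp (n + 1)) ^ 2 + B.dgNorm (wq (n + 1)) ^ 2)
              + 4 * c.𝓔p⁻¹ * dupd * normSqR (σp (n + 1))
              + c.𝓔q⁻¹ * dupd * Real.exp (-C / Real.sqrt (ε * 𝒥.step n)) * normSqR (σq (n + 1))
              + (jumpNormSq D η₀ (wp (n + 1)) + jumpNormSq D η₀ (wq (n + 1))))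
            + ((∫ x in Ω, c.sp (c.up (valW (wp 𝒥.N) x)))
              + ∫ x in Ω, c.sq (c.uq (valW (wq 𝒥.N) x)))
          ≤ (∫ x in Ω, c.sp (p₀ x)) + (∫ x in Ω, c.sq (q₀ x))
            + c.Cf * T * (c.𝓔q * volume.real Ω + Cstar Ω c q₀ Cqu T)) := by
  set S := Real.sqrt (entropyBound Ω c q₀ Cqu T / Ccoer)
  have hS0 : 0 ≤ S := Real.sqrt_nonneg _
  -- `‖w_q‖ ≤ S / √(ε τ)` in the DG norm; the summand `1` only ensures `C > 0`.
  refine ⟨CSob * S + 1, by positivity, ?_⟩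
  intro 𝒯 γ _ B hB hSob ε hε 𝒥 hqu hsmall wp wq σp σq hsol
  have hC := 𝒥.one_le_of_isQuasiUniform hT hqu
  have hstep : ∀ n < 𝒥.N,
      Ccoer * ε * 𝒥.step n * (B.dgNorm (wp (n + 1)) ^ 2 + B.dgNorm (wq (n + 1)) ^ 2)
        + (entropyAt c.sp c.up p₀ wp (n + 1) + entropyAt c.sq c.uq q₀ wq (n + 1))
        + 4 * c.𝓔p⁻¹ * dupd * 𝒥.step n * normSqR (σp (n + 1))
        + c.𝓔q⁻¹ * dupd * 𝒥.step n * Real.exp (-(CSob * S + 1) / Real.sqrt (ε * 𝒥.step n))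
          * normSqR (σq (n + 1))
        + 𝒥.step n * (jumpNormSq D η₀ (wp (n + 1)) + jumpNormSq D η₀ (wq (n + 1)))
      ≤ (entropyAt c.sp c.up p₀ wp n + entropyAt c.sq c.uq q₀ wq n)
        + c.Cf * 𝒥.step n * (c.𝓔q * volume.real Ω + Cstar Ω c q₀ Cqu T) := by
    intro n hn
    have hτ := 𝒥.step_pos hn
    have hετ := mul_pos hε hτ
    have hdg := hsol.dgNorm_q_le hΩb hD hη₀.le hq₀m hq₀ hε hCcoer hB hT hC hsmall hn
    have hA : CSob * B.dgNorm (wq (n + 1)) ≤ (CSob * S + 1) / Real.sqrt (ε * 𝒥.step n) := by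
      have h1 := mul_le_mul_of_nonneg_left hdg hCSob.le
      rw [← mul_div_assoc] at h1
      refine h1.trans ?_
      gcongr
      linarith
    have hq := hsol.entropy_q_le hΩb hD hη₀.le hq₀m hq₀ hn
      ((ae_valW_le (mul_nonneg hCSob.le (apply_nonneg _ _)) (hSob _)).mono
        fun x hx => hx.trans hA)
    have hp := hsol.entropy_p_le hΩb hD hη₀.le hp₀m hp₀ hn
    have hf := mul_le_mul_of_nonneg_left
      (integral_reaction_le (c := c) hΩb (wp (n + 1)) (wq (n + 1))) hτ.le
    rw [← entropyAt_succ c.sq c.uq q₀] at hf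
    have hCs := mul_le_mul_of_nonneg_left (hsol.entropyAt_q_le_Cstar hΩb hD hη₀.le hq₀m hq₀ hε.le
      (fun v => le_trans (by positivity) (hB v)) hT hC hsmall hn) (mul_pos c.Cf_pos hτ).le
    have hBp := mul_le_mul_of_nonneg_left (hB (wp (n + 1))) hετ.le
    have hBq := mul_le_mul_of_nonneg_left (hB (wq (n + 1))) hετ.le
    rw [neg_div]
    linarith
  refine ⟨fun n hn => ?_, ?_⟩
  · have h := hstep n hn
    rwa [entropyAt_succ, entropyAt_succ] at h
  · have hN : 𝒥.N ≠ 0 := by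
      intro h0
      have h1 := 𝒥.sum_step
      rw [h0, Finset.sum_range_zero] at h1
      exact hT.ne h1
    have hlast : ∀ (s u : ℝ → ℝ) (u₀ : Pt d → ℝ) (w : ℕ → 𝒯.W ℓ),
        ∫ x in Ω, s (u (valW (w 𝒥.N) x)) = entropyAt s u u₀ w 𝒥.N :=
      fun s u u₀ w => (if_neg hN).symm
    have hfirst : ∀ (s u : ℝ → ℝ) (u₀ : Pt d → ℝ) (w : ℕ → 𝒯.W ℓ),
        ∫ x in Ω, s (u₀ x) = entropyAt s u u₀ w 0 := fun s u u₀ w => (if_pos rfl).symm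
    rw [hlast c.sp c.up p₀, hlast c.sq c.uq q₀, hfirst c.sp c.up p₀ wp, hfirst c.sq c.uq q₀ wq]
    set G : ℕ → ℝ := fun n => entropyAt c.sp c.up p₀ wp n + entropyAt c.sq c.uq q₀ wq n with hG
    have htel := Finset.sum_range_sub G 𝒥.N
    have hst : ∑ n ∈ Finset.range 𝒥.N,
        c.Cf * 𝒥.step n * (c.𝓔q * volume.real Ω + Cstar Ω c q₀ Cqu T)
          = c.Cf * T * (c.𝓔q * volume.real Ω + Cstar Ω c q₀ Cqu T) := by
      rw [← Finset.sum_mul, ← Finset.mul_sum, 𝒥.sum_step]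
    have hle := Finset.sum_le_sum (s := Finset.range 𝒥.N) (f := fun n => 𝒥.step n *
            (Ccoer * ε * (B.dgNorm (wp (n + 1)) ^ 2 + B.dgNorm (wq (n + 1)) ^ 2)
              + 4 * c.𝓔p⁻¹ * dupd * normSqR (σp (n + 1))
              + c.𝓔q⁻¹ * dupd * Real.exp (-(CSob * S + 1) / Real.sqrt (ε * 𝒥.step n))
                * normSqR (σq (n + 1))
              + (jumpNormSq D η₀ (wp (n + 1)) + jumpNormSq D η₀ (wq (n + 1)))))
      (g := fun n => c.Cf * 𝒥.step n * (c.𝓔q * volume.real Ω + Cstar Ω c q₀ Cqu T)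
        - (G (n + 1) - G n)) fun n hn => by
          have := hstep n (Finset.mem_range.1 hn)
          simp only [hG]
          linarith
    rw [Finset.sum_sub_distrib, htel, hst] at hle
    simp only [hG] at hle
    linarith
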